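/- Let $a<b$ and let $\mu$ be a probability measure on $\mathbb R$ with $\{a,b\}\subset\operatorname{Supp}(\mu)\subset[a,b]$. Fix $(\chi,\eta)\in[a,b]\times[0,1]$. Let $C(w)=\int_a^b\frac{\mu[dx]}{w-x}$ be the Cauchy transform of $\mu$. Put $S_1:=\operatorname{Supp}(\mu|_{(\chi,b]})$, $S_3:=\operatorname{Supp}(\mu|_{[a,\chi)})$, and $S_2:=\{\chi\}$ if $\mu[\{\chi\}]\ne1-\eta$, $S_2:=\emptyset$ if $\mu[\{\chi\}]=1-\eta$; let $S:=S_1\cup S_2\cup S_3$. The function $$f'_{(\chi,\eta)}(w)=C(w)-\frac{1-\eta}{w-\chi}$$ extends analytically from $\mathbb C\setminus(\operatorname{Supp}(\mu)\cup\{\chi\})$ to $\mathbb C\setminus S$, the extension being $$f'_{(\chi,\eta)}(w)=\int_{(\chi,b]}\frac{\mu[dx]}{w-x}-\frac{1-\eta-\mu[\{\chi\}]}{w-\chi}+\int_{[a,\chi)}\frac{\mu[dx]}{w-x},$$ where the middle term is omitted if $\mu[\{\chi\}]=1-\eta$. Its domain is the disjoint union $\mathbb C\setminus S=(\mathbb C\setminus\mathbb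 R)\cup J\cup K$, where $J=J_1\cup J_2\cup J_3\cup J_4$, $K=\mathbb R\setminus(S\cup J)$, and - $J_1=(\sup S,+\infty)$ and $J_2=(-\infty,\inf S)$; - $J_3=(\chi,\inf S_1)$ if $S_1\neq\emptyset$, $S_2=\{\chi\}$ and $\inf S_1>\chi$, and $J_3=\emptyset$ otherwise; - $J_4=(\sup S_3,\chi)$ if $S_3\neq\emptyset$, $S_2=\{\chi\}$ and $\chi>\sup S_3$, and $J_4=\emptyset$ otherwise. Let $\{K_1,K_2,\dots\}$ be the (empty, finite or countable) family of connected components of $K$. Exactly one of the following holds for $\chi$: - $a<\chi<b$ (then $S_1\ne\emptyset\neq S_3$); - $\chi=a$ (then $S_1\neq\emptyset=S_3$); - $\chi=b$ (then $S_1=\emptyset\ne S_3$). Exactly one of the following holds for $\eta$: - (1) $0<\eta<1$ and $1-\eta>\mu[\{\chi\}]$; - (2) $\eta=0$ and $1-\eta>\mu[\{\chi\}]$; - (3) $0<\eta\le1$ and $1-\eta<\mu[\{\chi\}]$; - (4) $0<\eta\le1$ and $1-\eta=\mu[\{\chi\}]$. Here $S_2=\{\chi\}$ in (1), (2), (3)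 and $S_2=\emptyset$ in (4). The twelve combinations are labelled (a), (b), (c), (d) for $a<\chi<b$ with (1), (2), (3), (4); (e), (f), (g), (h) for $\chi=a$ with (1), (2), (3), (4); and (i), (j), (k), (l) for $\chi=b$ with (1), (2), (3), (4). Then, all roots of $f'_{(\chi,\eta)}$ in $\mathbb C\setminus S$ being counted with multiplicity: - **(a)** $f'_{(\chi,\eta)}$ has at most $2$ roots in each of $\{\mathbb C\setminus\mathbb R,J_1,J_2,J_3,J_4\}$ and at most $3$ roots in each of $\{K_1,K_2,\dots\}$. Moreover, if it has either $1$ or $2$ roots in some $I\in\{\mathbb C\setminus\mathbb R,J_1,J_2,J_3,J_4\}$, then it has $0$ roots in each of $\{\mathbb C\setminus\mathbb R,J_1,J_2,J_3,J_4\}\setminus\{I\}$ and at most $1$ root in each of $\{K_1,K_2,\dots\}$. Finally, if it has either $2$ or $3$ roots in some $L\in\{K_1,K_2,\dots\}$, then it has $0$ roots in each of $\{\mathbb C\setminus\mathbb R,J_1,J_2,J_3,J_4\}$ and at most $1$ root in each of $\{K_1,K_2,\dots\}\setminus\{L\}$. - **(b)** At most $1$ root in each of $\{J_1,J_2\}\cup\{K_1,K_2,\dots\}$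 and $0$ roots in each of $\{\mathbb C\setminus\mathbb R,J_3,J_4\}$. Moreover, if there is $1$ root in some $I\in\{J_1,J_2\}$, then there are $0$ roots in $\{J_1,J_2\}\setminus\{I\}$. - **(c)** $0$ roots in each of $\{\mathbb C\setminus\mathbb R,J_1,J_2\}$, and at most $1$ root in each of $\{J_3,J_4\}\cup\{K_1,K_2,\dots\}$. - **(d)** $0$ roots in each of $\{\mathbb C\setminus\mathbb R,J_1,J_2\}$, and at most $1$ root in each of $\{K_1,K_2,\dots\}$. - **(e)** $0$ roots in each of $\{\mathbb C\setminus\mathbb R,J_1,J_3\}$, and at most $1$ root in each of $\{J_2\}\cup\{K_1,K_2,\dots\}$. - **(f)** $0$ roots in each of $\{\mathbb C\setminus\mathbb R,J_1,J_2,J_3\}$, and at most $1$ root in each of $\{K_1,K_2,\dots\}$. - **(g)** $0$ roots in each of $\{\mathbb C\setminus\mathbb R,J_1,J_2\}$, and at most $1$ root in each of $\{J_3\}\cup\{K_1,K_2,\dots\}$. - **(h)** $0$ roots in each of $\{\mathbb C\setminus\mathbb R,J_1,J_2\}$, and at most $1$ root in each of $\{K_1,K_2,\dots\}$. - **(i)**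 $0$ roots in each of $\{\mathbb C\setminus\mathbb R,J_2,J_4\}$, and at most $1$ root in each of $\{J_1\}\cup\{K_1,K_2,\dots\}$. - **(j)** $0$ roots in each of $\{\mathbb C\setminus\mathbb R,J_1,J_2,J_4\}$, and at most $1$ root in each of $\{K_1,K_2,\dots\}$. - **(k)** $0$ roots in each of $\{\mathbb C\setminus\mathbb R,J_1,J_2\}$, and at most $1$ root in each of $\{J_4\}\cup\{K_1,K_2,\dots\}$. - **(l)** $0$ roots in each of $\{\mathbb C\setminus\mathbb R,J_1,J_2\}$, and at most $1$ root in each of $\{K_1,K_2,\dots\}$. -/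

import Mathlib

open MeasureTheory Set

noncomputable section

namespace GapRoots

/-- The support `S₁` of the restriction of `μ` to `(χ, b]`. -/
def S₁ (μ : Measure ℝ) (b χ : ℝ) : Set ℝ := (μ.restrict (Ioc χ b)).support

/-- `S₂ = {χ}` when `μ[{χ}] ≠ 1 - η`, and `S₂ = ∅` when `μ[{χ}] = 1 - η`. -/
def S₂ (μ : Measure ℝ) (χ η : ℝ) : Set ℝ := {x | x = χ ∧ μ.real {χ} ≠ 1 - η}

/-- The support `S₃` of the restriction of `μ` to `[a, χ)`. -/
def S₃ (μ : Measure ℝ) (a χ : ℝ) : Set ℝ := (μ.restrict (Ico a χ)).support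

/-- `S = S₁ ∪ S₂ ∪ S₃`. -/
def S (μ : Measure ℝ) (a b χ η : ℝ) : Set ℝ := S₁ μ b χ ∪ S₂ μ χ η ∪ S₃ μ a χ

/-- `J₁ = (sup S, +∞)`. -/
def J₁ (μ : Measure ℝ) (a b χ η : ℝ) : Set ℝ := Ioi (sSup (S μ a b χ η))

/-- `J₂ = (-∞, inf S)`. -/
def J₂ (μ : Measure ℝ) (a b χ η : ℝ) : Set ℝ := Iio (sInf (S μ a b χ η))

/-- `J₃ = (χ, inf S₁)` when `S₁ ≠ ∅` and `S₂ = {χ}`, otherwise `J₃ = ∅`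
(the interval is empty unless `inf S₁ > χ`). -/
def J₃ (μ : Measure ℝ) (b χ η : ℝ) : Set ℝ :=
  {x | (S₁ μ b χ).Nonempty ∧ S₂ μ χ η = {χ} ∧ x ∈ Ioo χ (sInf (S₁ μ b χ))}

/-- `J₄ = (sup S₃, χ)` when `S₃ ≠ ∅` and `S₂ = {χ}`, otherwise `J₄ = ∅`
(the interval is empty unless `χ > sup S₃`). -/
def J₄ (μ : Measure ℝ) (a χ η : ℝ) : Set ℝ :=
  {x | (S₃ μ a χ).Nonempty ∧ S₂ μ χ η = {χ} ∧ x ∈ Ioo (sSup (S₃ μ a χ)) χ}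

/-- `J = J₁ ∪ J₂ ∪ J₃ ∪ J₄`. -/
def J (μ : Measure ℝ) (a b χ η : ℝ) : Set ℝ :=
  J₁ μ a b χ η ∪ J₂ μ a b χ η ∪ J₃ μ b χ η ∪ J₄ μ a χ η

/-- `K = ℝ \ (S ∪ J)`. -/
def K (μ : Measure ℝ) (a b χ η : ℝ) : Set ℝ := (S μ a b χ η ∪ J μ a b χ η)ᶜ

/-- A set of real numbers, seen in the complex plane. -/
def inPlane (A : Set ℝ) : Set ℂ := Complex.ofReal '' A

/-- The family `{K₁, K₂, …}` of the connected components of `K`, seen in the complex plane. -/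
def KIntervals (μ : Measure ℝ) (a b χ η : ℝ) : Set (Set ℂ) :=
  {L | ∃ x ∈ K μ a b χ η, L = inPlane (connectedComponentIn (K μ a b χ η) x)}

/-- `ℂ \ ℝ`. -/
def nonReal : Set ℂ := {w | w.im ≠ 0}

/-- The Cauchy transform `C(w) = ∫ μ[dx] / (w - x)`, meant for `w` outside the support of `μ`. -/
def cauchyTransform (μ : Measure ℝ) (w : ℂ) : ℂ := ∫ x, 1 / (w - (x : ℂ)) ∂μ

/-- The function `w ↦ C(w) - (1 - η) / (w - χ)`, extended analytically to `ℂ \ S`: the mass of `μ`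
at `χ` is merged into the pole at `χ`. If `μ[{χ}] = 1 - η` then the middle term is zero for every
`w`, including `w = χ`. -/
def fPrime (μ : Measure ℝ) (a b χ η : ℝ) (w : ℂ) : ℂ :=
  (∫ x in Ioc χ b, 1 / (w - (x : ℂ)) ∂μ)
    - ((1 - η - μ.real {χ} : ℝ) : ℂ) / (w - (χ : ℂ))
    + ∫ x in Ico a χ, 1 / (w - (x : ℂ)) ∂μ

/-- The number of roots of `F` in `D`, counted with multiplicity (and `⊤` if it is infinite). The
multiplicity of `z` is the order of vanishing of the analytic function `F` at `z`. -/
def numRoots (F : ℂ → ℂ) (D : Set ℂ) : ℕ∞ :=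
  ⨆ (s : Finset ℂ) (_ : (s : Set ℂ) ⊆ D), ∑ z ∈ s, analyticOrderAt F z

/-- The conditions common to (a), (b), (c), (d). -/
def Inner (μ : Measure ℝ) (a b χ : ℝ) : Prop :=
  a < χ ∧ χ < b ∧ (S₁ μ b χ).Nonempty ∧ (S₃ μ a χ).Nonempty

/-- The conditions common to (e), (f), (g), (h). -/
def AtLeft (μ : Measure ℝ) (a b χ : ℝ) : Prop :=
  χ = a ∧ χ < b ∧ (S₁ μ b χ).Nonempty ∧ S₃ μ a χ = ∅

/-- The conditions common to (i), (j), (k), (l). -/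
def AtRight (μ : Measure ℝ) (a b χ : ℝ) : Prop :=
  a < χ ∧ χ = b ∧ S₁ μ b χ = ∅ ∧ (S₃ μ a χ).Nonempty

/-- The conditions common to (a), (e), (i). -/
def Generic (μ : Measure ℝ) (χ η : ℝ) : Prop :=
  0 < η ∧ η < 1 ∧ μ.real {χ} < 1 - η ∧ S₂ μ χ η = {χ}

/-- The conditions common to (b), (f), (j). -/
def Bottom (μ : Measure ℝ) (χ η : ℝ) : Prop :=
  η = 0 ∧ μ.real {χ} < 1 - η ∧ S₂ μ χ η = {χ}

/-- The conditions common to (c), (g), (k). -/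
def Heavy (μ : Measure ℝ) (χ η : ℝ) : Prop :=
  0 < η ∧ η ≤ 1 ∧ 1 - η < μ.real {χ} ∧ S₂ μ χ η = {χ}

/-- The conditions common to (d), (h), (l). -/
def Balanced (μ : Measure ℝ) (χ η : ℝ) : Prop :=
  0 < η ∧ η ≤ 1 ∧ 1 - η = μ.real {χ} ∧ S₂ μ χ η = ∅

end GapRoots

end

namespace GapRoots

/-! Off `S`, the function `fPrime` is the Stieltjes transform of a real signed measure ν: it is μ
away from χ, with an atom of weight `-(1 - η - μ.real {χ})` at χ. Its total mass is η, and the atom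
is its only possible negative part.

If a Stieltjes transform vanishes at z, dividing it by w - z yields the Stieltjes transform of the
measure divided by x - z. Iterating over k roots with monic product Q gives moment identities: for
every polynomial p of degree at most k, ∫ p/Q dν equals η times the coefficient of degree k of p
(`stieltjes_eq_rootProd_mul`). In particular the integral vanishes when deg p < k.

So k roots are impossible as soon as some real p of degree at most k makes p/Q dν nonnegative, and
positive away from χ, while η times that coefficient is at most 0
(`SignedRoots.false_of_polynomial`). Only the sign of Q on `S` matters. Conjugate pairs, roots left
of `S`, and an even number of roots in one gap make Q positive; each root right of `S` contributes a
factor -1; a root in `J₃` or `J₄` gives the sign of x - χ away from χ, and the two intervals differ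
only in the sign at χ itself.

Three test polynomials suffice. A constant is used when Q already has the right sign at χ, or when ν
is nonnegative; ε(x - χ) and ε(x - χ)² remove the negative atom when Q has the sign of x - χ,
respectively a constant sign. Each bound in the twelve cases compares the degree of the test
polynomial with the number of roots, the sign of ε settling the case of equality. -/

open Polynomial in
/-- Splitting off the value of a polynomial at a point, with control of degree and top coefficient. -/
lemma exists_eq_C_add_mul (p : ℂ[X]) (z : ℂ) (k : ℕ) (hp : p.natDegree ≤ k + 1) :
    ∃ q : ℂ[X], q.natDegree ≤ k ∧ q.coeff k = p.coeff (k + 1) ∧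
      ∀ w, p.eval w = p.eval z + (w - z) * q.eval w := by
  obtain ⟨q, hq⟩ := X_sub_C_dvd_sub_C_eval (p := p) (a := z)
  have hdeg : q.natDegree ≤ k := by
    rcases eq_or_ne q 0 with rfl | hq0
    · simp
    have h1 : (p - C (p.eval z)).natDegree = q.natDegree + 1 := by
      rw [hq, natDegree_mul (X_sub_C_ne_zero z) hq0, natDegree_X_sub_C, add_comm]
    have h2 : (p - C (p.eval z)).natDegree = p.natDegree := natDegree_sub_C
    omega
  have hpq : p = C (p.eval z) + (X - C z) * q := by rw [← hq]; ring
  refine ⟨q, hdeg, ?_, fun w => ?_⟩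
  · have h := congrArg (fun r : ℂ[X] => r.coeff (k + 1)) hpq
    simp only [coeff_add, coeff_C_succ, sub_mul, coeff_sub, coeff_X_mul, coeff_C_mul] at h
    rw [h, coeff_eq_zero_of_natDegree_lt (by omega : q.natDegree < k + 1)]
    ring
  · have h := congrArg (fun r : ℂ[X] => r.eval w) hpq
    simpa using h

/-! ### Analyticity of Stieltjes transforms -/

/-- The Stieltjes transform of the measure with density `φ` with respect to `ρ`. -/
noncomputable def stieltjes (ρ : Measure ℝ) (φ : ℝ → ℂ) (w : ℂ) : ℂ := ∫ x, φ x / (w - (x : ℂ)) ∂ρ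

lemma isClosed_inPlane {T : Set ℝ} (hT : IsClosed T) : IsClosed (inPlane T) :=
  Complex.isometry_ofReal.isClosedEmbedding.isClosedMap _ hT

lemma sub_ofReal_ne_zero {T : Set ℝ} {w : ℂ} (hw : w ∈ (inPlane T)ᶜ) {x : ℝ} (hx : x ∈ T) :
    w - (x : ℂ) ≠ 0 := fun h => hw ⟨x, hx, (sub_eq_zero.mp h).symm⟩

lemma integrable_mul_of_continuousOn {ρ : Measure ℝ} {T : Set ℝ} (hT : IsCompact T)
    (hρ : ∀ᵐ x ∂ρ, x ∈ T) {φ g : ℝ → ℂ} (hφ : Integrable φ ρ) (hg : ContinuousOn g T) :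
    Integrable (fun x => φ x * g x) ρ := by
  have h := Measure.restrict_eq_self_of_ae_mem hρ
  have h1 : IntegrableOn φ T ρ := hφ.integrableOn
  have h2 := h1.mul_continuousOn hg hT
  rwa [IntegrableOn, h] at h2

lemma continuousOn_inv_sub {T : Set ℝ} {w : ℂ} (hw : w ∈ (inPlane T)ᶜ) :
    ContinuousOn (fun x : ℝ => (w - (x : ℂ))⁻¹) T :=
  ContinuousOn.inv₀ (by fun_prop) fun _ hx => sub_ofReal_ne_zero hw hx

lemma integrable_div_sub {ρ : Measure ℝ} {T : Set ℝ} (hT : IsCompact T)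
    (hρ : ∀ᵐ x ∂ρ, x ∈ T) {φ : ℝ → ℂ} (hφ : Integrable φ ρ) {w : ℂ} (hw : w ∈ (inPlane T)ᶜ) :
    Integrable (fun x => φ x / (w - (x : ℂ))) ρ := by
  simpa only [div_eq_mul_inv] using integrable_mul_of_continuousOn hT hρ hφ (continuousOn_inv_sub hw)

/-- Differentiation under the integral: on a ball of half the distance to `T` the kernel stays at
least `ε / 2` away from its pole, which bounds its derivative uniformly. -/
lemma differentiableAt_stieltjes {ρ : Measure ℝ} {T : Set ℝ} (hT : IsCompact T)
    (hρ : ∀ᵐ x ∂ρ, x ∈ T) {φ : ℝ → ℂ} (hφ : Integrable φ ρ) {w : ℂ} (hw : w ∈ (inPlane T)ᶜ) :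
    DifferentiableAt ℂ (stieltjes ρ φ) w := by
  have hopen : IsOpen (inPlane T)ᶜ := (isClosed_inPlane hT.isClosed).isOpen_compl
  obtain ⟨ε, hε, hball⟩ := Metric.isOpen_iff.mp hopen w hw
  have hlow : ∀ x ∈ T, ∀ z ∈ Metric.ball w (ε / 2), ε / 2 ≤ ‖z - (x : ℂ)‖ := by
    intro x hx z hz
    have h1 : ε ≤ dist (x : ℂ) w := by
      by_contra h
      exact hball (Metric.mem_ball.mpr (not_le.mp h)) ⟨x, hx, rfl⟩
    have h2 := dist_triangle (x : ℂ) z w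
    have h3 := Metric.mem_ball.mp hz
    rw [dist_comm (x : ℂ) z, dist_eq_norm z] at h2
    linarith
  have hsub : ∀ z ∈ Metric.ball w (ε / 2), z ∈ (inPlane T)ᶜ := fun z hz =>
    hball (Metric.ball_subset_ball (by linarith) hz)
  have hmem : Metric.ball w (ε / 2) ∈ nhds w := Metric.ball_mem_nhds _ (by linarith)
  refine (hasDerivAt_integral_of_dominated_loc_of_deriv_le
    (F := fun z x => φ x / (z - (x : ℂ)))
    (F' := fun z x => -(φ x) / (z - (x : ℂ)) ^ 2)
    (bound := fun x => ‖φ x‖ * ((ε / 2) ^ 2)⁻¹) hmem ?_ ?_ ?_ ?_ ?_ ?_).2.differentiableAt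
  · filter_upwards [hmem] with z hz
    exact (integrable_div_sub hT hρ hφ (hsub z hz)).aestronglyMeasurable
  · exact integrable_div_sub hT hρ hφ hw
  · have h1 : ContinuousOn (fun x : ℝ => -((w - (x : ℂ))⁻¹ ^ 2)) T :=
      ((continuousOn_inv_sub hw).pow 2).neg
    refine (integrable_mul_of_continuousOn hT hρ hφ h1).aestronglyMeasurable.congr
      (Filter.Eventually.of_forall fun x => ?_)
    simp only [div_eq_mul_inv, inv_pow]
    ring
  · filter_upwards [hρ] with x hx z hz
    rw [norm_div, norm_neg, norm_pow, div_eq_mul_inv]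
    have := hlow x hx z hz
    gcongr
  · exact hφ.norm.mul_const _
  · filter_upwards [hρ] with x hx z hz
    have hne := sub_ofReal_ne_zero (hsub z hz) hx
    have h1 : HasDerivAt (fun y : ℂ => y - (x : ℂ)) 1 z := (hasDerivAt_id z).sub_const _
    have h2 := (hasDerivAt_const z (φ x)).div h1 hne
    rw [zero_mul, zero_sub, mul_one] at h2
    exact h2

lemma analyticOnNhd_stieltjes {ρ : Measure ℝ} {T : Set ℝ} (hT : IsCompact T)
    (hρ : ∀ᵐ x ∂ρ, x ∈ T) {φ : ℝ → ℂ} (hφ : Integrable φ ρ) :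
    AnalyticOnNhd ℂ (stieltjes ρ φ) (inPlane T)ᶜ :=
  DifferentiableOn.analyticOnNhd
    (fun _ hw => (differentiableAt_stieltjes hT hρ hφ hw).differentiableWithinAt)
    (isClosed_inPlane hT.isClosed).isOpen_compl

/-! ### Division by roots and the moment identities -/

/-- The monic polynomial function with root multiset `Z`. -/
noncomputable def rootProd (Z : Multiset ℂ) (w : ℂ) : ℂ := (Z.map fun z => w - z).prod

@[simp] lemma rootProd_zero (w : ℂ) : rootProd 0 w = 1 := by simp [rootProd]

@[simp] lemma rootProd_cons (z : ℂ) (Z : Multiset ℂ) (w : ℂ) :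
    rootProd (z ::ₘ Z) w = (w - z) * rootProd Z w := by simp [rootProd]

lemma rootProd_add (Z Z' : Multiset ℂ) (w : ℂ) :
    rootProd (Z + Z') w = rootProd Z w * rootProd Z' w := by simp [rootProd]

lemma analyticAt_rootProd (Z : Multiset ℂ) (w : ℂ) : AnalyticAt ℂ (rootProd Z) w := by
  induction Z using Multiset.induction with
  | empty =>
    have : rootProd 0 = fun _ => 1 := by ext w; simp
    rw [this]
    exact analyticAt_const
  | cons z Z ih =>
    have : rootProd (z ::ₘ Z) = (fun w => w - z) * rootProd Z := by
      ext w; simp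
    rw [this]
    exact (analyticAt_id.sub analyticAt_const).mul ih

lemma analyticOrderAt_rootProd (Z : Multiset ℂ) (w : ℂ) :
    analyticOrderAt (rootProd Z) w = Z.count w := by
  classical
  induction Z using Multiset.induction with
  | empty =>
    have h : rootProd 0 w ≠ 0 := by simp
    simpa using (analyticAt_rootProd 0 w).analyticOrderAt_eq_zero.mpr h
  | cons z Z ih =>
    have : rootProd (z ::ₘ Z) = (id - fun _ => z) * rootProd Z := by
      ext w; simp
    rw [this, analyticOrderAt_mul (analyticAt_id.sub analyticAt_const)
      (analyticAt_rootProd Z w), ih, Multiset.count_cons]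
    split_ifs with h
    · subst h
      have := analyticOrderAt_id_sub_const_self (𝕜 := ℂ) (c := w)
      simp only [Pi.sub_def, id] at this ⊢
      rw [this]; push_cast; ring
    · have := analyticOrderAt_id_sub_const_of_ne (𝕜 := ℂ) h
      simp only [Pi.sub_def, id] at this ⊢
      rw [this]; simp

lemma rootProd_ne_zero {Z : Multiset ℂ} {w : ℂ} (h : w ∉ Z) : rootProd Z w ≠ 0 := by
  rw [rootProd, Ne, Multiset.prod_eq_zero_iff]
  simp only [Multiset.mem_map, not_exists, not_and]
  intro z hz h0
  exact h (sub_eq_zero.mp h0 ▸ hz)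

/-- Dividing the Stieltjes transform by its roots amounts to dividing the density. -/
theorem stieltjes_eq_rootProd_mul {ρ : Measure ℝ} {T : Set ℝ} (hT : IsCompact T)
    (hρ : ∀ᵐ x ∂ρ, x ∈ T) {φ : ℝ → ℂ} (hφ : Integrable φ ρ) (Z : Multiset ℂ)
    (hZT : ∀ z ∈ Z, z ∈ (inPlane T)ᶜ)
    (hZ : ∀ z, (Z.count z : ℕ∞) ≤ analyticOrderAt (stieltjes ρ φ) z) :
    Integrable (fun x => φ x / rootProd Z x) ρ ∧
    (∀ w ∈ (inPlane T)ᶜ,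
      stieltjes ρ φ w = rootProd Z w * stieltjes ρ (fun x => φ x / rootProd Z x) w) ∧
    ∀ p : Polynomial ℂ, p.natDegree ≤ Z.card →
      ∫ x, φ x * p.eval (x : ℂ) / rootProd Z x ∂ρ = p.coeff Z.card * ∫ x, φ x ∂ρ := by
  classical
  induction Z using Multiset.induction with
  | empty =>
    refine ⟨by simpa using hφ, fun w _ => by simp, fun p hp => ?_⟩
    obtain ⟨a, rfl⟩ := Polynomial.natDegree_eq_zero.mp (Nat.le_zero.mp (by simpa using hp))
    simp only [Polynomial.eval_C, rootProd_zero, div_one, Multiset.card_zero,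
      Polynomial.coeff_C_zero]
    rw [integral_mul_const, mul_comm]
  | cons z Z ih =>
    have hzT : z ∈ (inPlane T)ᶜ := hZT z (Multiset.mem_cons_self z Z)
    obtain ⟨hint, hfac, hmom⟩ := ih (fun y hy => hZT y (Multiset.mem_cons_of_mem hy))
      (fun y => le_trans (by exact_mod_cast Multiset.count_le_count_cons y z Z) (hZ y))
    have hQ : ∀ x ∈ T, rootProd Z x ≠ 0 := fun x hx => rootProd_ne_zero fun h =>
      hZT _ (Multiset.mem_cons_of_mem h) ⟨x, hx, rfl⟩
    have hg := analyticOnNhd_stieltjes hT hρ hint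
    have hopen : IsOpen (inPlane T)ᶜ := (isClosed_inPlane hT.isClosed).isOpen_compl
    -- The roots already divided out account for exactly `Z.count z` of the order of vanishing at
    -- `z`. The order is at least one more, so the quotient still vanishes at `z`.
    have hzero : stieltjes ρ (fun x => φ x / rootProd Z x) z = 0 := by
      have h1 := hZ z
      have h2 : stieltjes ρ φ =ᶠ[nhds z]
          rootProd Z * stieltjes ρ (fun x => φ x / rootProd Z x) :=
        Filter.eventuallyEq_of_mem (hopen.mem_nhds hzT) hfac
      rw [analyticOrderAt_congr h2, analyticOrderAt_mul (analyticAt_rootProd Z z) (hg z hzT),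
        analyticOrderAt_rootProd, Multiset.count_cons_self] at h1
      refine apply_eq_zero_of_analyticOrderAt_ne_zero fun h => ?_
      rw [h, add_zero] at h1
      have h3 : Z.count z + 1 ≤ Z.count z := by exact_mod_cast h1
      omega
    have hdiv : ∀ x : ℝ, φ x / rootProd (z ::ₘ Z) x = -(φ x / rootProd Z x / (z - (x : ℂ))) := by
      intro x
      rw [rootProd_cons, div_div, ← div_neg]
      congr 1
      ring
    have hint' : Integrable (fun x => φ x / rootProd (z ::ₘ Z) x) ρ := by
      simp only [hdiv]
      exact (integrable_div_sub hT hρ hint hzT).neg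
    refine ⟨hint', fun w hw => ?_, fun p hp => ?_⟩
    · rw [hfac w hw, rootProd_cons, mul_assoc, mul_left_comm]
      congr 1
      -- Subtracting the zero value at `z` turns the kernel into 1/(w - x) - 1/(z - x) = (w - z)/((w
      -- - x)(x - z)).
      rw [← sub_zero (stieltjes ρ (fun x => φ x / rootProd Z x) w), ← hzero]
      unfold stieltjes
      rw [← integral_sub (integrable_div_sub hT hρ hint hw) (integrable_div_sub hT hρ hint hzT),
        ← integral_const_mul]
      refine integral_congr_ae ?_
      filter_upwards [hρ] with x hx
      have h1 := sub_ofReal_ne_zero hw hx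
      have h2 := sub_ofReal_ne_zero hzT hx
      have h3 := hQ x hx
      rw [hdiv x]
      field_simp
      ring
    · rw [Multiset.card_cons] at hp ⊢
      obtain ⟨q, hq1, hq2, hq3⟩ := exists_eq_C_add_mul p z Z.card hp
      rw [← hq2, ← hmom q hq1]
      have hiq : Integrable (fun x : ℝ => φ x * q.eval (x : ℂ) / rootProd Z x) ρ := by
        have hc : ContinuousOn (fun x : ℝ => q.eval (x : ℂ)) T :=
          (q.continuous.comp Complex.continuous_ofReal).continuousOn
        refine (integrable_mul_of_continuousOn hT hρ hint hc).congr
          (Filter.Eventually.of_forall fun x => ?_)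
        simp only
        ring
      -- With p = p(z) + (x - z)q, the first term integrates to a multiple of the vanishing value at
      -- `z`; the second is the induction hypothesis for `q`, which has the same top coefficient.
      have hsplit : ∀ᵐ x ∂ρ, φ x * p.eval (x : ℂ) / rootProd (z ::ₘ Z) x =
          -(p.eval z * (φ x / rootProd Z x / (z - (x : ℂ)))) +
            φ x * q.eval (x : ℂ) / rootProd Z x := by
        filter_upwards [hρ] with x hx
        have h2 := sub_ofReal_ne_zero hzT hx
        have h3 := hQ x hx
        have h4 : (x : ℂ) - z ≠ 0 := by rw [← neg_sub]; exact neg_ne_zero.mpr h2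
        rw [hq3 (x : ℂ), rootProd_cons, ← neg_sub (x : ℂ) z]
        field_simp
      have hi1 : Integrable (fun x : ℝ => -(p.eval z * (φ x / rootProd Z x / (z - (x : ℂ))))) ρ :=
        ((integrable_div_sub hT hρ hint hzT).const_mul _).neg
      rw [integral_congr_ae hsplit, integral_add hi1 hiq, integral_neg, integral_const_mul]
      change -(p.eval z * stieltjes ρ (fun x => φ x / rootProd Z x) z) + _ = _
      rw [hzero]
      simp

/-! ### Multisets of roots -/

-- Reflecting a local factorization (w - z)ⁿ g(w) replaces g by its conjugate under complex
-- conjugation, which is again analytic.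
open ComplexConjugate in
lemma analyticOrderAt_conj_le {F : ℂ → ℂ} (hF : ∀ w, F (conj w) = conj (F w)) {z : ℂ}
    (hz : AnalyticAt ℂ F z) (hz' : AnalyticAt ℂ F (conj z)) {n : ℕ}
    (hn : (n : ℕ∞) ≤ analyticOrderAt F z) : (n : ℕ∞) ≤ analyticOrderAt F (conj z) := by
  rw [natCast_le_analyticOrderAt hz] at hn
  rw [natCast_le_analyticOrderAt hz']
  obtain ⟨g, hg, hFg⟩ := hn
  have hcont : Filter.Tendsto conj (nhds (conj z)) (nhds z) := by
    have := (Complex.continuous_conj.tendsto (conj z))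
    rwa [Complex.conj_conj] at this
  refine ⟨conj ∘ g ∘ conj, ?_, ?_⟩
  · rw [Complex.analyticAt_iff_eventually_differentiableAt] at hg ⊢
    filter_upwards [hcont.eventually hg] with w hw
    have := hw.conj_conj
    rwa [Complex.conj_conj] at this
  · filter_upwards [hcont.eventually hFg] with w hw
    have h1 := hF w
    rw [hw] at h1
    have h2 := congrArg conj h1
    rw [Complex.conj_conj] at h2
    rw [← h2]
    simp

lemma exists_le_of_le_card {α : Type*} {s : Multiset α} {n : ℕ} (h : n ≤ s.card) :
    ∃ t ≤ s, t.card = n := by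
  have hpos : 0 < (s.powersetCard n).card := by
    rw [Multiset.card_powersetCard]
    exact Nat.choose_pos h
  obtain ⟨t, ht⟩ := Multiset.card_pos_iff_exists_mem.mp hpos
  exact ⟨t, Multiset.mem_powersetCard.mp ht⟩

/-- A domain with more than `n` roots contains a multiset of `n + 1` roots. -/
lemma exists_multiset_of_lt_numRoots {F : ℂ → ℂ} {D : Set ℂ} {n : ℕ} (h : (n : ℕ∞) < numRoots F D) :
    ∃ Z : Multiset ℂ, Z.card = n + 1 ∧ (∀ z ∈ Z, z ∈ D) ∧
      ∀ z, (Z.count z : ℕ∞) ≤ analyticOrderAt F z := by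
  classical
  simp only [numRoots, lt_iSup_iff] at h
  obtain ⟨s, hs, hlt⟩ := h
  -- Truncating the orders at `n + 1` keeps them finite, even where `F` vanishes identically nearby,
  -- and loses nothing since only `n + 1` roots are needed.
  set m : ℂ → ℕ := fun z => (min (analyticOrderAt F z) ((n + 1 : ℕ) : ℕ∞)).toNat with hm
  have hmc : ∀ z, (m z : ℕ∞) = min (analyticOrderAt F z) ((n + 1 : ℕ) : ℕ∞) := fun z =>
    ENat.natCast_toNat (ne_top_of_le_ne_top (ENat.natCast_ne_top (n + 1)) (min_le_right _ _))
  have hcard : n + 1 ≤ ∑ z ∈ s, m z := by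
    by_cases hbig : ∃ z ∈ s, ((n + 1 : ℕ) : ℕ∞) ≤ analyticOrderAt F z
    · obtain ⟨z, hz, hle⟩ := hbig
      have h1 : m z = n + 1 := by
        have := hmc z
        rw [min_eq_right hle] at this
        exact_mod_cast this
      rw [← h1]
      exact Finset.single_le_sum (f := m) (fun _ _ => Nat.zero_le _) hz
    · push Not at hbig
      have h1 : ∑ z ∈ s, analyticOrderAt F z = ((∑ z ∈ s, m z : ℕ) : ℕ∞) := by
        rw [Nat.cast_sum]
        refine Finset.sum_congr rfl fun z hz => ?_
        rw [hmc, min_eq_left (hbig z hz).le]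
      rw [h1] at hlt
      have : n < ∑ z ∈ s, m z := by exact_mod_cast hlt
      omega
  have hcount : ∀ z, (∑ y ∈ s, Multiset.replicate (m y) y).count z = if z ∈ s then m z else 0 := by
    intro z
    rw [Multiset.count_sum']
    simp only [Multiset.count_replicate]
    rw [Finset.sum_ite_eq' s z m]
  have hcard' : (∑ y ∈ s, Multiset.replicate (m y) y).card = ∑ z ∈ s, m z := by
    rw [Multiset.card_sum]; simp
  obtain ⟨Z, hZ, hZc⟩ := exists_le_of_le_card (hcard'.symm ▸ hcard)
  have hle : ∀ z, Z.count z ≤ if z ∈ s then m z else 0 := fun z =>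
    (Multiset.count_le_of_le z hZ).trans (hcount z).le
  refine ⟨Z, hZc, fun z hz => ?_, fun z => ?_⟩
  · have h1 := Multiset.one_le_count_iff_mem.mpr hz
    have h2 := hle z
    split_ifs at h2 with h3
    · exact hs h3
    · omega
  · have h2 := hle z
    split_ifs at h2 with h3
    · calc (Z.count z : ℕ∞) ≤ m z := by exact_mod_cast h2
        _ ≤ _ := by rw [hmc]; exact min_le_left _ _
    · have : Z.count z = 0 := by omega
      simp [this]

/-! ### Sign patterns of root products -/

/-- `F` has `k` roots in `D` such that the monic polynomial with these roots has the sign of `σ`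
on `T`. -/
def SignedRoots (F : ℂ → ℂ) (T : Set ℝ) (D : Set ℂ) (k : ℕ) (σ : ℝ → ℝ) : Prop :=
  ∃ Z : Multiset ℂ, Z.card = k ∧ (∀ z ∈ Z, z ∈ D) ∧
    (∀ z, (Z.count z : ℕ∞) ≤ analyticOrderAt F z) ∧
    ∀ x ∈ T, ∃ q : ℝ, 0 < q ∧ rootProd Z x = ((q * σ x : ℝ) : ℂ)

section SignedRoots

variable {F : ℂ → ℂ} {T : Set ℝ}

lemma SignedRoots.union {D D' : Set ℂ} (hD : Disjoint D D') {k k' : ℕ} {σ σ' : ℝ → ℝ}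
    (h : SignedRoots F T D k σ) (h' : SignedRoots F T D' k' σ') :
    SignedRoots F T (D ∪ D') (k + k') (fun x => σ x * σ' x) := by
  classical
  obtain ⟨Z, hk, hZD, hZ, hs⟩ := h
  obtain ⟨Z', hk', hZD', hZ', hs'⟩ := h'
  refine ⟨Z + Z', by simp [hk, hk'], fun z hz => ?_, fun z => ?_, fun x hx => ?_⟩
  · rcases Multiset.mem_add.mp hz with h | h
    exacts [Or.inl (hZD z h), Or.inr (hZD' z h)]
  · rw [Multiset.count_add]
    by_cases hz : z ∈ Z
    · have : z ∉ Z' := fun h => Set.disjoint_left.mp hD (hZD z hz) (hZD' z h)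
      rw [Multiset.count_eq_zero_of_notMem this, add_zero]
      exact hZ z
    · rw [Multiset.count_eq_zero_of_notMem hz, zero_add]
      exact hZ' z
  · obtain ⟨q, hq, he⟩ := hs x hx
    obtain ⟨q', hq', he'⟩ := hs' x hx
    refine ⟨q * q', mul_pos hq hq', ?_⟩
    rw [rootProd_add, he, he']
    push_cast
    ring

lemma signedRoots_of_lt_numRoots {A : Set ℝ} {n : ℕ} (h : (n : ℕ∞) < numRoots F (inPlane A))
    {σ : ℝ → ℝ} (hσ : ∀ t ∈ A, ∀ x ∈ T, ∃ q : ℝ, 0 < q ∧ x - t = q * σ x) :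
    SignedRoots F T (inPlane A) (n + 1) (fun x => σ x ^ (n + 1)) := by
  obtain ⟨Z, hk, hZD, hZ⟩ := exists_multiset_of_lt_numRoots h
  refine ⟨Z, hk, hZD, hZ, fun x hx => ?_⟩
  rw [← hk]
  clear h hk hZ
  induction Z using Multiset.induction with
  | empty => exact ⟨1, one_pos, by simp⟩
  | cons z Z ih =>
    obtain ⟨q, hq, he⟩ := ih fun y hy => hZD y (Multiset.mem_cons_of_mem hy)
    obtain ⟨t, ht, rfl⟩ := hZD z (Multiset.mem_cons_self z Z)
    obtain ⟨r, hr, he'⟩ := hσ t ht x hx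
    refine ⟨r * q, mul_pos hr hq, ?_⟩
    rw [rootProd_cons, he, ← Complex.ofReal_sub, he', Multiset.card_cons]
    push_cast
    ring

lemma signedRoots_of_gap {A : Set ℝ} {m : ℕ}
    (h : ((2 * m + 1 : ℕ) : ℕ∞) < numRoots F (inPlane A))
    (hA : ∀ t ∈ A, ∀ t' ∈ A, ∀ x ∈ T, 0 < (x - t) * (x - t')) :
    SignedRoots F T (inPlane A) (2 * m + 2) (fun _ => 1) := by
  -- Any one root serves as reference: every factor x - t has the sign of x - t₀, and an even power
  -- of the latter is positive.
  obtain ⟨Z, hk, hZD, -⟩ := exists_multiset_of_lt_numRoots h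
  obtain ⟨z, hz⟩ := Multiset.card_pos_iff_exists_mem.mp (by omega : 0 < Z.card)
  obtain ⟨t₀, ht₀, -⟩ := hZD z hz
  have hne : ∀ x ∈ T, x - t₀ ≠ 0 := fun x hx h => by
    have := hA t₀ ht₀ t₀ ht₀ x hx
    simp [h] at this
  obtain ⟨Z, hk, hZD, hZ, hs⟩ := signedRoots_of_lt_numRoots (T := T) (σ := fun x => x - t₀) h
    (fun t ht x hx => ⟨(x - t) / (x - t₀), by
      have h1 := hA t ht t₀ ht₀ x hx
      have h2 := hne x hx
      have h3 : (x - t) / (x - t₀) = (x - t) * (x - t₀) / (x - t₀) ^ 2 := by field_simp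
      rw [h3]
      positivity, by rw [div_mul_cancel₀ _ (hne x hx)]⟩)
  refine ⟨Z, hk, hZD, hZ, fun x hx => ?_⟩
  obtain ⟨q, hq, he⟩ := hs x hx
  refine ⟨q * (x - t₀) ^ (2 * m + 1 + 1), mul_pos hq ?_, by rw [he, mul_one]⟩
  have := hne x hx
  have h2 : (x - t₀) ^ (2 * m + 1 + 1) = ((x - t₀) ^ (m + 1)) ^ 2 := by ring
  rw [h2]
  positivity

-- Adjoining the conjugates makes the product |Q|² on the real line, hence positive. Multiplicities
-- do not collide because the two halves lie in opposite half-planes.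
open ComplexConjugate in
lemma signedRoots_conj (hF : ∀ w, F (conj w) = conj (F w)) (hA : AnalyticOnNhd ℂ F nonReal)
    {U : Multiset ℂ} (hU : ∀ z ∈ U, 0 < z.im)
    (hc : ∀ z, (U.count z : ℕ∞) ≤ analyticOrderAt F z) :
    SignedRoots F T nonReal (2 * U.card) (fun _ => 1) := by
  classical
  have hinj : Function.Injective (conj : ℂ → ℂ) := (starRingEnd ℂ).injective
  refine ⟨U + U.map conj, by simp [two_mul], fun z hz => ?_, fun z => ?_, fun x hx => ?_⟩
  · rcases Multiset.mem_add.mp hz with h | h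
    · exact (hU z h).ne'
    · obtain ⟨y, hy, rfl⟩ := Multiset.mem_map.mp h
      simpa [nonReal] using (hU y hy).ne'
  · rw [Multiset.count_add]
    by_cases hz : z ∈ U
    · have : z ∉ U.map conj := fun h => by
        obtain ⟨y, hy, rfl⟩ := Multiset.mem_map.mp h
        have h1 := hU y hy
        have h2 := hU _ hz
        rw [Complex.conj_im] at h2
        linarith
      rw [Multiset.count_eq_zero_of_notMem this, add_zero]
      exact hc z
    · rw [Multiset.count_eq_zero_of_notMem hz, zero_add]
      by_cases hz' : z ∈ U.map conj
      · obtain ⟨y, hy, rfl⟩ := Multiset.mem_map.mp hz'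
        rw [Multiset.count_map_eq_count' _ _ hinj]
        refine analyticOrderAt_conj_le hF (hA y (hU y hy).ne') (hA _ ?_) (hc y)
        simpa [nonReal] using (hU y hy).ne'
      · rw [Multiset.count_eq_zero_of_notMem hz']
        simp
  · have hne : rootProd U x ≠ 0 := rootProd_ne_zero fun h => by simpa using hU _ h
    refine ⟨Complex.normSq (rootProd U x), Complex.normSq_pos.mpr hne, ?_⟩
    have : rootProd (U.map conj) x = conj (rootProd U x) := by
      simp only [rootProd, Multiset.map_map]
      rw [map_multiset_prod, Multiset.map_map]
      simp
    rw [rootProd_add, this, Complex.mul_conj, mul_one]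

-- Pigeonhole: of 2m + 1 nonreal roots at least m + 1 lie in one half-plane, and reflection produces
-- 2(m + 1) roots in conjugate pairs.
open ComplexConjugate in
lemma signedRoots_of_nonReal (hF : ∀ w, F (conj w) = conj (F w))
    (hA : AnalyticOnNhd ℂ F nonReal) {m : ℕ} (h : ((2 * m : ℕ) : ℕ∞) < numRoots F nonReal) :
    SignedRoots F T nonReal (2 * (m + 1)) (fun _ => 1) := by
  classical
  have hinj : Function.Injective (conj : ℂ → ℂ) := (starRingEnd ℂ).injective
  obtain ⟨Z, hk, hZD, hZ⟩ := exists_multiset_of_lt_numRoots h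
  obtain ⟨U, hUcard, hU, hUc⟩ : ∃ U : Multiset ℂ, m + 1 ≤ U.card ∧ (∀ z ∈ U, 0 < z.im) ∧
      ∀ z, (U.count z : ℕ∞) ≤ analyticOrderAt F z := by
    have hsum := congrArg Multiset.card (Multiset.filter_add_not (fun z : ℂ => 0 < z.im) Z)
    rw [Multiset.card_add, hk] at hsum
    by_cases hc : m + 1 ≤ (Z.filter fun z : ℂ => 0 < z.im).card
    · refine ⟨_, hc, fun z hz => (Multiset.mem_filter.mp hz).2, fun z => le_trans ?_ (hZ z)⟩
      exact_mod_cast Multiset.count_le_of_le z (Multiset.filter_le _ Z)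
    · have hneg : ∀ z ∈ Z.filter (fun z : ℂ => ¬ 0 < z.im), z.im < 0 := fun z hz =>
        lt_of_le_of_ne (not_lt.mp (Multiset.mem_filter.mp hz).2)
          (hZD z (Multiset.mem_filter.mp hz).1)
      refine ⟨(Z.filter fun z : ℂ => ¬ 0 < z.im).map conj, by rw [Multiset.card_map]; omega,
        fun z hz => ?_, fun z => ?_⟩
      · obtain ⟨y, hy, rfl⟩ := Multiset.mem_map.mp hz
        have := hneg y hy
        rw [Complex.conj_im]
        linarith
      · by_cases hz : z ∈ (Z.filter fun z : ℂ => ¬ 0 < z.im).map conj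
        · obtain ⟨y, hy, rfl⟩ := Multiset.mem_map.mp hz
          rw [Multiset.count_map_eq_count' _ _ hinj]
          refine analyticOrderAt_conj_le hF (hA y (hneg y hy).ne) (hA _ ?_) (le_trans ?_ (hZ y))
          · simpa [nonReal] using (hneg y hy).ne
          · exact_mod_cast Multiset.count_le_of_le y (Multiset.filter_le _ Z)
        · rw [Multiset.count_eq_zero_of_notMem hz]
          simp
  obtain ⟨V, hV, hVc⟩ := exists_le_of_le_card hUcard
  rw [← hVc]
  exact signedRoots_conj hF hA (fun z hz => hU z (Multiset.mem_of_le hV hz))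
    fun z => le_trans (by exact_mod_cast Multiset.count_le_of_le z hV) (hUc z)

end SignedRoots

/-! ### `fPrime` as the transform of a signed measure -/

section Representation

/-- The measure `μ` on `[a, b]` with the point `χ` removed. -/
noncomputable def sideMeasure (μ : Measure ℝ) (a b χ : ℝ) : Measure ℝ :=
  μ.restrict (Ioc χ b) + μ.restrict (Ico a χ)

/-- The total variation of the signed measure whose Stieltjes transform is `fPrime`. -/
noncomputable def gapMeasure (μ : Measure ℝ) (a b χ η : ℝ) : Measure ℝ :=
  sideMeasure μ a b χ + ENNReal.ofReal |1 - η - μ.real {χ}| • Measure.dirac χ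

/-- The sign density of the signed measure whose Stieltjes transform is `fPrime`. -/
noncomputable def gapDensity (μ : Measure ℝ) (χ η x : ℝ) : ℝ :=
  open Classical in if x = χ ∧ μ.real {χ} < 1 - η then -1 else 1

variable {μ : Measure ℝ} {a b χ η : ℝ}

lemma S₁_subset : S₁ μ b χ ⊆ Icc χ b := fun _ hx =>
  closure_minimal Ioc_subset_Icc_self isClosed_Icc (Measure.support_restrict_subset hx).1

lemma S₃_subset : S₃ μ a χ ⊆ Icc a χ := fun _ hx =>
  closure_minimal Ico_subset_Icc_self isClosed_Icc (Measure.support_restrict_subset hx).1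

lemma S₂_subset : S₂ μ χ η ⊆ {χ} := fun _ hx => hx.1

lemma isCompact_S : IsCompact (S μ a b χ η) := by
  have h1 : IsCompact (S₁ μ b χ) :=
    isCompact_Icc.of_isClosed_subset Measure.isClosed_support S₁_subset
  have h3 : IsCompact (S₃ μ a χ) :=
    isCompact_Icc.of_isClosed_subset Measure.isClosed_support S₃_subset
  have h2 : IsCompact (S₂ μ χ η) := ((finite_singleton χ).subset S₂_subset).isCompact
  exact (h1.union h2).union h3

lemma ae_sideMeasure : ∀ᵐ x ∂(sideMeasure μ a b χ), x ∈ S μ a b χ η ∧ x ≠ χ := by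
  rw [sideMeasure, ae_add_measure_iff]
  constructor
  · filter_upwards [Measure.support_mem_ae (μ := μ.restrict (Ioc χ b)),
      ae_restrict_mem measurableSet_Ioc] with x hx hx'
    exact ⟨Or.inl (Or.inl hx), hx'.1.ne'⟩
  · filter_upwards [Measure.support_mem_ae (μ := μ.restrict (Ico a χ)),
      ae_restrict_mem measurableSet_Ico] with x hx hx'
    exact ⟨Or.inr hx, hx'.2.ne⟩

/-- The point χ counts exactly when its atom has nonzero weight, which is the condition defining
`S₂`. -/
lemma ae_gapMeasure_iff {P : ℝ → Prop} :
    (∀ᵐ x ∂(gapMeasure μ a b χ η), P x) ↔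
      (∀ᵐ x ∂(sideMeasure μ a b χ), P x) ∧ (μ.real {χ} ≠ 1 - η → P χ) := by
  rw [gapMeasure, ae_add_measure_iff]
  refine and_congr_right fun _ => ?_
  by_cases h : μ.real {χ} = 1 - η
  · simp [h]
  · have h0 : ENNReal.ofReal |1 - η - μ.real {χ}| ≠ 0 := by
      rw [Ne, ENNReal.ofReal_eq_zero, not_le, abs_pos, sub_ne_zero]
      exact fun h' => h h'.symm
    rw [Measure.ae_ennreal_smul_measure_iff h0, ae_dirac_eq]
    simp [h]

lemma ae_mem_S : ∀ᵐ x ∂(gapMeasure μ a b χ η), x ∈ S μ a b χ η :=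
  ae_gapMeasure_iff.mpr ⟨ae_sideMeasure.mono fun _ h => h.1, fun h => Or.inl (Or.inr ⟨rfl, h⟩)⟩

lemma measurable_gapDensity : Measurable (gapDensity μ χ η) := by
  classical
  refine Measurable.ite ?_ measurable_const measurable_const
  by_cases h : μ.real {χ} < 1 - η <;> simp [h]

lemma gapDensity_of_ne {x : ℝ} (h : x ≠ χ) : gapDensity μ χ η x = 1 := by
  simp [gapDensity, h]

lemma gapDensity_self_mul :
    |1 - η - μ.real {χ}| * gapDensity μ χ η χ = -(1 - η - μ.real {χ}) := by
  unfold gapDensity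
  split_ifs with h
  · rw [abs_of_pos (by linarith [h.2])]; ring
  · have : ¬ μ.real {χ} < 1 - η := fun h' => h ⟨rfl, h'⟩
    rw [abs_of_nonpos (by linarith)]; ring

lemma abs_gapDensity_le (x : ℝ) : ‖(gapDensity μ χ η x : ℂ)‖ ≤ 1 := by
  unfold gapDensity
  split_ifs <;> simp

lemma integral_gapMeasure {g : ℝ → ℂ} (hg : Integrable g (sideMeasure μ a b χ)) :
    ∫ x, (gapDensity μ χ η x : ℂ) * g x ∂(gapMeasure μ a b χ η) =
      (∫ x in Ioc χ b, g x ∂μ) - ((1 - η - μ.real {χ} : ℝ) : ℂ) * g χ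
        + ∫ x in Ico a χ, g x ∂μ := by
  have h0 : (fun x => (gapDensity μ χ η x : ℂ) * g x) =ᵐ[sideMeasure μ a b χ] g :=
    (ae_sideMeasure (η := η)).mono fun x hx => by simp [gapDensity_of_ne hx.2]
  have h1 : Integrable (fun x => (gapDensity μ χ η x : ℂ) * g x) (sideMeasure μ a b χ) :=
    hg.congr h0.symm
  have h2 : Integrable (fun x => (gapDensity μ χ η x : ℂ) * g x)
      (ENNReal.ofReal |1 - η - μ.real {χ}| • Measure.dirac χ) :=
    (integrable_dirac enorm_lt_top).smul_measure ENNReal.ofReal_ne_top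
  rw [gapMeasure, integral_add_measure h1 h2, integral_congr_ae h0, integral_smul_measure,
    integral_dirac, ENNReal.toReal_ofReal (abs_nonneg _)]
  rw [sideMeasure, integrable_add_measure] at hg
  rw [sideMeasure, integral_add_measure hg.1 hg.2, Complex.real_smul, ← mul_assoc,
    ← Complex.ofReal_mul, gapDensity_self_mul]
  push_cast
  ring

lemma integral_eq_add (ha : a ≤ χ) (hb : χ ≤ b) (hsupp : μ.support ⊆ Icc a b) {g : ℝ → ℂ}
    (hg : Integrable g μ) :
    ∫ x, g x ∂μ = (∫ x in Ioc χ b, g x ∂μ) + (μ.real {χ} : ℂ) * g χ + ∫ x in Ico a χ, g x ∂μ := by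
  have h1 : μ.restrict (Icc a b) = μ := Measure.restrict_eq_self_of_ae_mem
    (Filter.mem_of_superset Measure.support_mem_ae hsupp)
  have h2 : Ico a χ ∪ ({χ} ∪ Ioc χ b) = Icc a b := by
    rw [singleton_union, Ioc_insert_left hb, Ico_union_Icc_eq_Icc ha hb]
  have hd1 : Disjoint ({χ} : Set ℝ) (Ioc χ b) := by simp
  have hd2 : Disjoint (Ico a χ) ({χ} ∪ Ioc χ b) := by
    rw [Set.disjoint_left]
    rintro x hx (hx' | hx')
    · exact hx.2.ne hx'
    · exact lt_asymm hx.2 hx'.1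
  conv_lhs => rw [← h1, ← h2]
  rw [setIntegral_union hd2 ((measurableSet_singleton χ).union measurableSet_Ioc)
    hg.integrableOn hg.integrableOn, setIntegral_union hd1 measurableSet_Ioc hg.integrableOn
    hg.integrableOn, integral_singleton, Complex.real_smul]
  ring

open ComplexConjugate in
lemma fPrime_conj (w : ℂ) : fPrime μ a b χ η (conj w) = conj (fPrime μ a b χ η w) := by
  have h : ∀ s : Set ℝ, ∫ x in s, 1 / (conj w - (x : ℂ)) ∂μ =
      conj (∫ x in s, 1 / (w - (x : ℂ)) ∂μ) := fun s => by
    rw [← integral_conj]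
    simp
  simp only [fPrime, h, map_add, map_sub, map_div₀, Complex.conj_ofReal]

lemma nonReal_subset : nonReal ⊆ (inPlane (S μ a b χ η))ᶜ := by
  rintro w hw ⟨x, -, rfl⟩
  simp [nonReal] at hw

variable [IsProbabilityMeasure μ]

instance : IsFiniteMeasure (sideMeasure μ a b χ) := by
  unfold sideMeasure; infer_instance

instance : IsFiniteMeasure (gapMeasure μ a b χ η) := by
  unfold gapMeasure
  have : IsFiniteMeasure (ENNReal.ofReal |1 - η - μ.real {χ}| • Measure.dirac χ) :=
    Measure.smul_finite _ ENNReal.ofReal_ne_top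
  infer_instance


lemma integrable_gapDensity :
    Integrable (fun x => (gapDensity μ χ η x : ℂ)) (gapMeasure μ a b χ η) :=
  Integrable.of_bound
    (Complex.measurable_ofReal.comp measurable_gapDensity).aestronglyMeasurable 1
    (Filter.Eventually.of_forall abs_gapDensity_le)

lemma fPrime_eq_stieltjes {w : ℂ} (hw : w ∈ (inPlane (S μ a b χ η))ᶜ) :
    fPrime μ a b χ η w =
      stieltjes (gapMeasure μ a b χ η) (fun x => (gapDensity μ χ η x : ℂ)) w := by
  have hint : Integrable (fun x : ℝ => 1 / (w - (x : ℂ))) (sideMeasure μ a b χ) :=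
    integrable_div_sub (isCompact_S (η := η)) (ae_sideMeasure.mono fun _ h => h.1)
      (integrable_const 1) hw
  have := integral_gapMeasure (η := η) hint
  simp only [mul_one_div] at this
  rw [stieltjes, this, fPrime]

lemma analyticOnNhd_fPrime : AnalyticOnNhd ℂ (fPrime μ a b χ η) (inPlane (S μ a b χ η))ᶜ :=
  (analyticOnNhd_stieltjes isCompact_S ae_mem_S integrable_gapDensity).congr
    (isClosed_inPlane isCompact_S.isClosed).isOpen_compl fun _ hw => (fPrime_eq_stieltjes hw).symm

lemma fPrime_eq_cauchyTransform (ha : a ≤ χ) (hb : χ ≤ b) (hsupp : μ.support ⊆ Icc a b) {w : ℂ}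
    (hw : w ∈ (inPlane (μ.support ∪ {χ}))ᶜ) :
    fPrime μ a b χ η w = cauchyTransform μ w - (1 - (η : ℂ)) / (w - (χ : ℂ)) := by
  have hw' : w ∈ (inPlane μ.support)ᶜ := fun h => hw (image_mono subset_union_left h)
  have hint : Integrable (fun x : ℝ => 1 / (w - (x : ℂ))) μ :=
    integrable_div_sub (isCompact_Icc.of_isClosed_subset Measure.isClosed_support hsupp)
      Measure.support_mem_ae (integrable_const 1) hw'
  rw [cauchyTransform, integral_eq_add ha hb hsupp hint, fPrime]
  push_cast
  ring

/-- The mass away from χ is 1 - μ{χ}; adding the atom -(1 - η - μ{χ}) leaves η. This is the only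
quantity besides signs that enters the moment identities. -/
lemma integral_gapDensity (ha : a ≤ χ) (hb : χ ≤ b) (hsupp : μ.support ⊆ Icc a b) :
    ∫ x, (gapDensity μ χ η x : ℂ) ∂(gapMeasure μ a b χ η) = η := by
  have h1 := integral_gapMeasure (μ := μ) (a := a) (b := b) (χ := χ) (η := η)
    (g := fun _ => 1) (integrable_const 1)
  have h2 := integral_eq_add ha hb hsupp (integrable_const (1 : ℂ))
  simp only [mul_one] at h1
  rw [h1]
  simp only [integral_const, probReal_univ, one_smul, mul_one] at h2 ⊢
  push_cast
  linear_combination -h2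

/-- Roots of `fPrime` are impossible when some polynomial, divided by the monic polynomial with
these roots, is positive with respect to the signed measure, while its leading coefficient is not. -/
theorem SignedRoots.false_of_polynomial (ha : a ≤ χ) (hb : χ ≤ b) (hsupp : μ.support ⊆ Icc a b)
    (hside : sideMeasure μ a b χ ≠ 0) {D : Set ℂ} (hD : D ⊆ (inPlane (S μ a b χ η))ᶜ) {k : ℕ}
    {σ : ℝ → ℝ} (h : SignedRoots (fPrime μ a b χ η) (S μ a b χ η) D k σ) (p : Polynomial ℝ)
    (hp : p.natDegree ≤ k) (hpos : ∀ x ∈ S μ a b χ η, x ≠ χ → 0 < p.eval x * σ x)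
    (hχ : 0 ≤ -(1 - η - μ.real {χ}) * (p.eval χ * σ χ)) (hcoeff : η * p.coeff k ≤ 0) : False := by
  obtain ⟨Z, hk, hZD, hZ, hs⟩ := h
  have hopen : IsOpen (inPlane (S μ a b χ η))ᶜ :=
    (isClosed_inPlane isCompact_S.isClosed).isOpen_compl
  have hZ' : ∀ z, (Z.count z : ℕ∞) ≤ analyticOrderAt
      (stieltjes (gapMeasure μ a b χ η) (fun x => (gapDensity μ χ η x : ℂ))) z := by
    intro z
    by_cases hz : z ∈ Z
    · refine (hZ z).trans (analyticOrderAt_congr ?_).le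
      exact Filter.eventuallyEq_of_mem (hopen.mem_nhds (hD (hZD z hz)))
        fun w hw => fPrime_eq_stieltjes hw
    · rw [Multiset.count_eq_zero_of_notMem hz]
      simp
  obtain ⟨hint, -, hmom⟩ := stieltjes_eq_rootProd_mul isCompact_S ae_mem_S integrable_gapDensity Z
    (fun z hz => hD (hZD z hz)) hZ'
  have hmom' := hmom (p.map Complex.ofRealHom) (by simpa [hk] using hp)
  have hintp : Integrable (fun x : ℝ => (gapDensity μ χ η x : ℂ) / rootProd Z x *
      ((p.eval x : ℝ) : ℂ)) (gapMeasure μ a b χ η) :=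
    integrable_mul_of_continuousOn isCompact_S ae_mem_S hint
      (Complex.continuous_ofReal.comp p.continuous).continuousOn
  -- The product of the roots is real on `S`, so the complex moment identity becomes a statement
  -- about a real integrand.
  set G : ℝ → ℝ := fun x => gapDensity μ χ η x * p.eval x / (rootProd Z x).re with hG
  have hGC : ∀ x ∈ S μ a b χ η, (gapDensity μ χ η x : ℂ) / rootProd Z x *
      ((p.eval x : ℝ) : ℂ) = (G x : ℂ) := by
    intro x hx
    obtain ⟨q, hq, he⟩ := hs x hx
    simp only [hG]
    rw [he, Complex.ofReal_re]
    push_cast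
    ring
  have hGint : Integrable G (gapMeasure μ a b χ η) := by
    have := (hintp.congr (ae_mem_S.mono hGC)).re
    simpa using this
  have hGval : ∫ x, G x ∂(gapMeasure μ a b χ η) = p.coeff k * η := by
    have h1 : ∫ x, (G x : ℂ) ∂(gapMeasure μ a b χ η) = p.coeff k * η := by
      rw [integral_gapDensity ha hb hsupp, hk, Polynomial.coeff_map] at hmom'
      rw [← integral_congr_ae (ae_mem_S.mono hGC)]
      refine Eq.trans (integral_congr_ae (Filter.Eventually.of_forall fun x => ?_)) hmom'
      simp only
      rw [Polynomial.eval_map, show (x : ℂ) = Complex.ofRealHom x from rfl,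
        Polynomial.eval₂_at_apply]
      simp only [Complex.ofRealHom_eq_coe]
      ring
    rw [integral_complex_ofReal] at h1
    exact_mod_cast h1
  -- Dividing by qσ is multiplying by σ and by the nonnegative number 1/(qσ²). If σ vanishes, both
  -- sides are 0 by the convention for division by zero, so σ may vanish at χ.
  have hsign : ∀ x ∈ S μ a b χ η, ∃ r : ℝ, 0 ≤ r ∧ (σ x ≠ 0 → 0 < r) ∧
      G x = r * (gapDensity μ χ η x * (p.eval x * σ x)) := by
    intro x hx
    obtain ⟨q, hq, he⟩ := hs x hx
    refine ⟨(q * σ x ^ 2)⁻¹, by positivity, fun h => by positivity, ?_⟩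
    simp only [hG]
    rw [he, Complex.ofReal_re]
    rcases eq_or_ne (σ x) 0 with h0 | h0
    · simp [h0]
    · field_simp
  have hGside : ∀ᵐ x ∂(sideMeasure μ a b χ), 0 < G x := by
    filter_upwards [ae_sideMeasure (η := η)] with x hx
    have h1 := hpos x hx.1 hx.2
    obtain ⟨r, -, hr, he⟩ := hsign x hx.1
    rw [he, gapDensity_of_ne hx.2, one_mul]
    exact mul_pos (hr (right_ne_zero_of_mul h1.ne')) h1
  have hGnonneg : ∀ᵐ x ∂(gapMeasure μ a b χ η), 0 ≤ G x := by
    refine ae_gapMeasure_iff.mpr ⟨hGside.mono fun _ h => h.le, fun hne => ?_⟩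
    obtain ⟨r, hr, -, he⟩ := hsign χ (Or.inl (Or.inr ⟨rfl, hne⟩))
    rw [he]
    refine mul_nonneg hr ?_
    have habs : 0 < |1 - η - μ.real {χ}| := by
      rw [abs_pos, sub_ne_zero]; exact fun h => hne h.symm
    refine nonneg_of_mul_nonneg_right (?_ : 0 ≤ |1 - η - μ.real {χ}| * _) habs
    rwa [← mul_assoc, gapDensity_self_mul]
  -- A nonnegative integrand with nonpositive integral vanishes almost everywhere, yet it is
  -- positive almost everywhere for the nonzero side measure.
  have hzero : ∫ x, G x ∂(gapMeasure μ a b χ η) = 0 :=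
    le_antisymm (by rw [hGval, mul_comm]; exact hcoeff) (integral_nonneg_of_ae hGnonneg)
  have hae := (ae_gapMeasure_iff.mp ((integral_eq_zero_iff_of_nonneg_ae hGnonneg hGint).mp hzero)).1
  refine hside (ae_eq_bot.mp (Filter.eventually_false_iff_eq_bot.mp ?_))
  filter_upwards [hae, hGside] with x h1 h2
  exact h2.ne' h1

end Representation

/-! ### Signs of x - t for x in `S` and t in each interval -/

section Position

variable {μ : Measure ℝ} {a b χ η : ℝ}

lemma inPlane_subset_compl {A T : Set ℝ} (h : Disjoint A T) : inPlane A ⊆ (inPlane T)ᶜ :=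
  Set.subset_compl_iff_disjoint_right.mpr
    ((Set.disjoint_image_iff Complex.ofReal_injective).mpr h)

lemma disjoint_inPlane {A B : Set ℝ} (h : ∀ t ∈ A, t ∉ B) : Disjoint (inPlane A) (inPlane B) :=
  (Set.disjoint_image_iff Complex.ofReal_injective).mpr (Set.disjoint_left.mpr h)

lemma disjoint_nonReal_inPlane (A : Set ℝ) : Disjoint nonReal (inPlane A) := by
  rw [Set.disjoint_left]
  rintro w hw ⟨x, -, rfl⟩
  simp [nonReal] at hw

lemma lt_of_mem_J₁ {t x : ℝ} (ht : t ∈ J₁ μ a b χ η) (hx : x ∈ S μ a b χ η) : x < t :=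
  (le_csSup isCompact_S.bddAbove hx).trans_lt ht

lemma lt_of_mem_J₂ {t x : ℝ} (ht : t ∈ J₂ μ a b χ η) (hx : x ∈ S μ a b χ η) : t < x :=
  lt_of_lt_of_le ht (csInf_le isCompact_S.bddBelow hx)

lemma lt_of_mem_S₁ {t x : ℝ} (ht : t ∈ J₃ μ b χ η) (hx : x ∈ S₁ μ b χ) : t < x :=
  lt_of_lt_of_le ht.2.2.2 (csInf_le (bddBelow_Icc.mono S₁_subset) hx)

lemma lt_of_mem_S₃ {t x : ℝ} (ht : t ∈ J₄ μ a χ η) (hx : x ∈ S₃ μ a χ) : x < t :=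
  (le_csSup (bddAbove_Icc.mono S₃_subset) hx).trans_lt ht.2.2.1

lemma le_or_lt_of_mem_J₃ {t x : ℝ} (ht : t ∈ J₃ μ b χ η) (hx : x ∈ S μ a b χ η) :
    x ≤ χ ∨ t < x := by
  rcases hx with (hx | hx) | hx
  exacts [Or.inr (lt_of_mem_S₁ ht hx), Or.inl hx.1.le, Or.inl (S₃_subset hx).2]

lemma le_or_lt_of_mem_J₄ {t x : ℝ} (ht : t ∈ J₄ μ a χ η) (hx : x ∈ S μ a b χ η) :
    χ ≤ x ∨ x < t := by
  rcases hx with (hx | hx) | hx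
  exacts [Or.inl (S₁_subset hx).1, Or.inl hx.1.ge, Or.inr (lt_of_mem_S₃ ht hx)]

lemma J₁_disjoint_S : Disjoint (J₁ μ a b χ η) (S μ a b χ η) :=
  Set.disjoint_left.mpr fun _ ht hx => lt_irrefl _ (lt_of_mem_J₁ ht hx)

lemma J₂_disjoint_S : Disjoint (J₂ μ a b χ η) (S μ a b χ η) :=
  Set.disjoint_left.mpr fun _ ht hx => lt_irrefl _ (lt_of_mem_J₂ ht hx)

lemma J₃_disjoint_S : Disjoint (J₃ μ b χ η) (S μ a b χ η) :=
  Set.disjoint_left.mpr fun _ ht hx =>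
    (le_or_lt_of_mem_J₃ ht hx).elim (not_le.mpr ht.2.2.1) (lt_irrefl _)

lemma J₄_disjoint_S : Disjoint (J₄ μ a χ η) (S μ a b χ η) :=
  Set.disjoint_left.mpr fun _ ht hx =>
    (le_or_lt_of_mem_J₄ ht hx).elim (not_le.mpr ht.2.2.2) (lt_irrefl _)

variable {F : ℂ → ℂ} {n : ℕ}

lemma signedRoots_J₁ (h : (n : ℕ∞) < numRoots F (inPlane (J₁ μ a b χ η))) :
    SignedRoots F (S μ a b χ η) (inPlane (J₁ μ a b χ η)) (n + 1) (fun _ => (-1) ^ (n + 1)) :=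
  signedRoots_of_lt_numRoots (σ := fun _ => -1) h fun t ht x hx =>
    ⟨t - x, sub_pos.mpr (lt_of_mem_J₁ ht hx), by ring⟩

lemma signedRoots_J₂ (h : (n : ℕ∞) < numRoots F (inPlane (J₂ μ a b χ η))) :
    SignedRoots F (S μ a b χ η) (inPlane (J₂ μ a b χ η)) (n + 1) (fun _ => 1 ^ (n + 1)) :=
  signedRoots_of_lt_numRoots (σ := fun _ => 1) h fun t ht x hx =>
    ⟨x - t, sub_pos.mpr (lt_of_mem_J₂ ht hx), by ring⟩

/-- The sign of `x - t` for `x ∈ S` and `t ∈ J₃`. -/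
noncomputable def sign₃ (χ x : ℝ) : ℝ := if x ≤ χ then -1 else 1

/-- The sign of `x - t` for `x ∈ S` and `t ∈ J₄`. -/
noncomputable def sign₄ (χ x : ℝ) : ℝ := if x < χ then -1 else 1

lemma signedRoots_J₃ (h : (n : ℕ∞) < numRoots F (inPlane (J₃ μ b χ η))) :
    SignedRoots F (S μ a b χ η) (inPlane (J₃ μ b χ η)) (n + 1) (fun x => sign₃ χ x ^ (n + 1)) :=
  signedRoots_of_lt_numRoots h fun t ht x hx => by
    have h1 := ht.2.2.1
    unfold sign₃
    split_ifs with hc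
    · exact ⟨t - x, by linarith, by ring⟩
    · have h2 := (le_or_lt_of_mem_J₃ ht hx).resolve_left hc
      exact ⟨x - t, by linarith, by ring⟩

lemma signedRoots_J₄ (h : (n : ℕ∞) < numRoots F (inPlane (J₄ μ a χ η))) :
    SignedRoots F (S μ a b χ η) (inPlane (J₄ μ a χ η)) (n + 1) (fun x => sign₄ χ x ^ (n + 1)) :=
  signedRoots_of_lt_numRoots h fun t ht x hx => by
    have h1 := ht.2.2.2
    unfold sign₄
    split_ifs with hc
    · have h2 := (le_or_lt_of_mem_J₄ ht hx).resolve_left (not_le.mpr hc)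
      exact ⟨t - x, by linarith, by ring⟩
    · exact ⟨x - t, by linarith, by ring⟩

lemma subset_K_of_mem_KIntervals {L : Set ℂ} (hL : L ∈ KIntervals μ a b χ η) :
    ∃ A ⊆ K μ a b χ η, IsPreconnected A ∧ L = inPlane A := by
  obtain ⟨x, -, rfl⟩ := hL
  exact ⟨_, connectedComponentIn_subset _ _, isPreconnected_connectedComponentIn, rfl⟩

lemma disjoint_K_S : Disjoint (K μ a b χ η) (S μ a b χ η) :=
  Set.disjoint_left.mpr fun _ ht hx => ht (Or.inl hx)

lemma KIntervals_subset {L : Set ℂ} (hL : L ∈ KIntervals μ a b χ η) :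
    L ⊆ (inPlane (S μ a b χ η))ᶜ := by
  obtain ⟨A, hA, -, rfl⟩ := subset_K_of_mem_KIntervals hL
  exact inPlane_subset_compl (disjoint_K_S.mono_left hA)

lemma disjoint_KIntervals {L L' : Set ℂ} (hL : L ∈ KIntervals μ a b χ η)
    (hL' : L' ∈ KIntervals μ a b χ η) (hne : L ≠ L') : Disjoint L L' := by
  obtain ⟨x, -, rfl⟩ := hL
  obtain ⟨y, -, rfl⟩ := hL'
  refine disjoint_inPlane fun t ht ht' => hne ?_
  rw [connectedComponentIn_eq ht, connectedComponentIn_eq ht']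

lemma disjoint_KIntervals_J {L : Set ℂ} (hL : L ∈ KIntervals μ a b χ η) {A : Set ℝ}
    (hA : A ⊆ J μ a b χ η) : Disjoint (inPlane A) L := by
  obtain ⟨B, hB, -, rfl⟩ := subset_K_of_mem_KIntervals hL
  exact disjoint_inPlane fun t ht ht' => hB ht' (Or.inr (hA ht))

lemma disjoint_nonReal_KIntervals {L : Set ℂ} (hL : L ∈ KIntervals μ a b χ η) :
    Disjoint nonReal L := by
  obtain ⟨B, -, -, rfl⟩ := subset_K_of_mem_KIntervals hL
  exact disjoint_nonReal_inPlane B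

/-- A component is order-connected and misses `S`, so no point of `S` separates two of its roots. -/
lemma signedRoots_KIntervals {L : Set ℂ} (hL : L ∈ KIntervals μ a b χ η)
    (h : ((2 * n + 1 : ℕ) : ℕ∞) < numRoots F L) :
    SignedRoots F (S μ a b χ η) L (2 * n + 2) (fun _ => 1) := by
  obtain ⟨A, hA, hconn, rfl⟩ := subset_K_of_mem_KIntervals hL
  have hAS := Set.disjoint_left.mp (disjoint_K_S.mono_left hA)
  refine signedRoots_of_gap h fun t ht t' ht' x hx => ?_
  have h1 : t ≠ x := fun e => hAS ht (e ▸ hx)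
  have h2 : t' ≠ x := fun e => hAS ht' (e ▸ hx)
  rcases lt_or_gt_of_ne h1 with h1 | h1 <;> rcases lt_or_gt_of_ne h2 with h2 | h2
  · exact mul_pos (by linarith) (by linarith)
  · exact absurd hx (hAS (hconn.ordConnected.out ht ht' ⟨h1.le, h2.le⟩))
  · exact absurd hx (hAS (hconn.ordConnected.out ht' ht ⟨h2.le, h1.le⟩))
  · exact mul_pos_of_neg_of_neg (by linarith) (by linarith)

lemma lt_or_gt_of_mem_S {x : ℝ} (hx : x ∈ S μ a b χ η) (hne : x ≠ χ) :
    (x ∈ S₁ μ b χ ∧ χ < x) ∨ (x ∈ S₃ μ a χ ∧ x < χ) := by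
  rcases hx with (hx | hx) | hx
  exacts [Or.inl ⟨hx, lt_of_le_of_ne (S₁_subset hx).1 hne.symm⟩, absurd hx.1 hne,
    Or.inr ⟨hx, lt_of_le_of_ne (S₃_subset hx).2 hne⟩]

end Position

/-- The standing assumptions on the measure and the point `χ`. -/
structure Setting (μ : Measure ℝ) (a b χ : ℝ) : Prop where
  left : a ≤ χ
  right : χ ≤ b
  supp : μ.support ⊆ Icc a b
  side : sideMeasure μ a b χ ≠ 0

/-! ### Test polynomials of degree 0, 1 and 2 -/

section Exclusion

variable {μ : Measure ℝ} [IsProbabilityMeasure μ] {a b χ η : ℝ} {D : Set ℂ} {k : ℕ} {σ : ℝ → ℝ}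

lemma signedRoots_nonReal {T : Set ℝ} {m : ℕ}
    (h : ((2 * m : ℕ) : ℕ∞) < numRoots (fPrime μ a b χ η) nonReal) :
    SignedRoots (fPrime μ a b χ η) T nonReal (2 * (m + 1)) (fun _ => 1) :=
  signedRoots_of_nonReal fPrime_conj (analyticOnNhd_fPrime.mono nonReal_subset) h

-- A constant has degree below `k`, so the mass η plays no role; the price is a sign condition on
-- the atom at χ.
open Polynomial in
lemma SignedRoots.false_of_const (st : Setting μ a b χ) (hD : D ⊆ (inPlane (S μ a b χ η))ᶜ)
    (h : SignedRoots (fPrime μ a b χ η) (S μ a b χ η) D k σ) (hk : 1 ≤ k) (ε : ℝ)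
    (hpos : ∀ x ∈ S μ a b χ η, x ≠ χ → 0 < ε * σ x)
    (hχ : 0 ≤ -(1 - η - μ.real {χ}) * (ε * σ χ)) : False := by
  refine h.false_of_polynomial st.left st.right st.supp st.side hD (C ε) (by simp) ?_ ?_ ?_
  · simpa using hpos
  · simpa using hχ
  · rw [coeff_C_of_ne_zero (by omega), mul_zero]

-- The zero at χ removes the atom whatever its sign. The top coefficient matters only when there is
-- a single root.
open Polynomial in
lemma SignedRoots.false_of_linear (st : Setting μ a b χ) (hD : D ⊆ (inPlane (S μ a b χ η))ᶜ)
    (h : SignedRoots (fPrime μ a b χ η) (S μ a b χ η) D k σ) (hk : 1 ≤ k) (ε : ℝ)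
    (hpos : ∀ x ∈ S μ a b χ η, x ≠ χ → 0 < ε * ((x - χ) * σ x))
    (hlead : 2 ≤ k ∨ η * ε ≤ 0) : False := by
  have hdeg : (C ε * (X - C χ)).natDegree ≤ 1 :=
    (natDegree_C_mul_le _ _).trans (natDegree_X_sub_C χ).le
  refine h.false_of_polynomial st.left st.right st.supp st.side hD (C ε * (X - C χ))
    (hdeg.trans hk) ?_ (by simp) ?_
  · intro x hx hne
    have := hpos x hx hne
    simpa [mul_assoc] using this
  · rcases hk.eq_or_lt with rfl | hk
    · have := hlead.resolve_left (by norm_num)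
      simpa [coeff_X, coeff_C] using this
    · rw [coeff_eq_zero_of_natDegree_lt (by omega), mul_zero]

-- The double zero removes the atom without changing signs elsewhere, at the cost of one more root;
-- the top coefficient matters only for exactly two roots.
open Polynomial in
lemma SignedRoots.false_of_quadratic (st : Setting μ a b χ) (hD : D ⊆ (inPlane (S μ a b χ η))ᶜ)
    (h : SignedRoots (fPrime μ a b χ η) (S μ a b χ η) D k σ) (hk : 2 ≤ k) (ε : ℝ)
    (hpos : ∀ x ∈ S μ a b χ η, x ≠ χ → 0 < ε * σ x)
    (hlead : 3 ≤ k ∨ η * ε ≤ 0) : False := by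
  have hmonic : ((X - C χ : ℝ[X]) ^ 2).Monic := (monic_X_sub_C χ).pow 2
  have hdeg2 : ((X - C χ : ℝ[X]) ^ 2).natDegree = 2 := by
    rw [natDegree_pow, natDegree_X_sub_C]
  have hdeg : (C ε * (X - C χ) ^ 2).natDegree ≤ 2 := (natDegree_C_mul_le _ _).trans hdeg2.le
  refine h.false_of_polynomial st.left st.right st.supp st.side hD (C ε * (X - C χ) ^ 2)
    (hdeg.trans hk) ?_ (by simp) ?_
  · intro x hx hne
    have h1 := hpos x hx hne
    have h2 : 0 < (x - χ) ^ 2 := by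
      have := sub_ne_zero.mpr hne
      positivity
    have h3 := mul_pos h1 h2
    simp only [eval_mul, eval_C, eval_pow, eval_sub, eval_X]
    linarith
  · rcases hk.eq_or_lt with rfl | hk
    · have := hlead.resolve_left (by norm_num)
      have hc : ((X - C χ : ℝ[X]) ^ 2).coeff 2 = 1 := by
        have := hmonic.coeff_natDegree
        rwa [hdeg2] at this
      rwa [coeff_C_mul, hc, mul_one]
    · rw [coeff_eq_zero_of_natDegree_lt (by omega), mul_zero]

end Exclusion

/-! ### Even and odd sign patterns -/

section Cases

variable {μ : Measure ℝ} {a b χ η : ℝ}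

/-- `k` roots in `D` whose monic polynomial has the sign `ε` on `S` away from `χ`. -/
def EvenRoots (μ : Measure ℝ) (a b χ η : ℝ) (D : Set ℂ) (k : ℕ) (ε : ℝ) : Prop :=
  D ⊆ (inPlane (S μ a b χ η))ᶜ ∧ ∃ σ, SignedRoots (fPrime μ a b χ η) (S μ a b χ η) D k σ ∧
    ∀ x ∈ S μ a b χ η, x ≠ χ → 0 < ε * σ x

/-- `k` roots in `D` whose monic polynomial has the sign of `x - χ` on `S` away from `χ`. -/
def OddRoots (μ : Measure ℝ) (a b χ η : ℝ) (D : Set ℂ) (k : ℕ) : Prop :=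
  D ⊆ (inPlane (S μ a b χ η))ᶜ ∧ ∃ σ, SignedRoots (fPrime μ a b χ η) (S μ a b χ η) D k σ ∧
    ∀ x ∈ S μ a b χ η, x ≠ χ → 0 < (x - χ) * σ x

lemma EvenRoots.union {D D' : Set ℂ} {k k' : ℕ} {ε ε' : ℝ} (h : EvenRoots μ a b χ η D k ε)
    (h' : EvenRoots μ a b χ η D' k' ε') (hd : Disjoint D D') :
    EvenRoots μ a b χ η (D ∪ D') (k + k') (ε * ε') := by
  obtain ⟨hD, σ, hs, hp⟩ := h
  obtain ⟨hD', σ', hs', hp'⟩ := h'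
  refine ⟨union_subset hD hD', _, hs.union hd hs', fun x hx hne => ?_⟩
  have := mul_pos (hp x hx hne) (hp' x hx hne)
  linarith

lemma sign₃_of_gt {x : ℝ} (h : χ < x) : sign₃ χ x = 1 := by simp [sign₃, h]
lemma sign₃_of_le {x : ℝ} (h : x ≤ χ) : sign₃ χ x = -1 := by simp [sign₃, h]
lemma sign₄_of_ge {x : ℝ} (h : χ ≤ x) : sign₄ χ x = 1 := by simp [sign₄, h]
lemma sign₄_of_lt {x : ℝ} (h : x < χ) : sign₄ χ x = -1 := by simp [sign₄, h]

lemma sub_mul_sign₃_pos {x : ℝ} (h : x ≠ χ) : 0 < (x - χ) * sign₃ χ x := by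
  rcases lt_or_gt_of_ne h with h | h
  · rw [sign₃_of_le h.le]; linarith
  · rw [sign₃_of_gt h]; linarith

lemma sub_mul_sign₄_pos {x : ℝ} (h : x ≠ χ) : 0 < (x - χ) * sign₄ χ x := by
  rcases lt_or_gt_of_ne h with h | h
  · rw [sign₄_of_lt h]; linarith
  · rw [sign₄_of_ge h.le]; linarith

lemma sign₃_sq (x : ℝ) : sign₃ χ x ^ 2 = 1 := by unfold sign₃; split_ifs <;> norm_num
lemma sign₄_sq (x : ℝ) : sign₄ χ x ^ 2 = 1 := by unfold sign₄; split_ifs <;> norm_num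

lemma sign₃_pow_three (x : ℝ) : sign₃ χ x ^ 3 = sign₃ χ x := by rw [pow_succ, sign₃_sq, one_mul]
lemma sign₄_pow_three (x : ℝ) : sign₄ χ x ^ 3 = sign₄ χ x := by rw [pow_succ, sign₄_sq, one_mul]

section Counts

variable {n : ℕ}

lemma evenRoots_J₁ (h : (n : ℕ∞) < numRoots (fPrime μ a b χ η) (inPlane (J₁ μ a b χ η))) :
    EvenRoots μ a b χ η (inPlane (J₁ μ a b χ η)) (n + 1) ((-1) ^ (n + 1)) := by
  refine ⟨inPlane_subset_compl J₁_disjoint_S, _, signedRoots_J₁ h, fun x _ _ => ?_⟩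
  rw [← mul_pow]; norm_num

lemma evenRoots_J₂ (h : (n : ℕ∞) < numRoots (fPrime μ a b χ η) (inPlane (J₂ μ a b χ η))) :
    EvenRoots μ a b χ η (inPlane (J₂ μ a b χ η)) (n + 1) 1 :=
  ⟨inPlane_subset_compl J₂_disjoint_S, _, signedRoots_J₂ h, fun x _ _ => by norm_num⟩

lemma oddRoots_J₃ (h : ((0 : ℕ) : ℕ∞) < numRoots (fPrime μ a b χ η) (inPlane (J₃ μ b χ η))) :
    OddRoots μ a b χ η (inPlane (J₃ μ b χ η)) 1 :=
  ⟨inPlane_subset_compl J₃_disjoint_S, _, signedRoots_J₃ h, fun x _ hne => by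
    simpa using sub_mul_sign₃_pos hne⟩

lemma oddRoots_J₄ (h : ((0 : ℕ) : ℕ∞) < numRoots (fPrime μ a b χ η) (inPlane (J₄ μ a χ η))) :
    OddRoots μ a b χ η (inPlane (J₄ μ a χ η)) 1 :=
  ⟨inPlane_subset_compl J₄_disjoint_S, _, signedRoots_J₄ h, fun x _ hne => by
    simpa using sub_mul_sign₄_pos hne⟩

lemma oddRoots_three_J₃ (h : ((2 : ℕ) : ℕ∞) < numRoots (fPrime μ a b χ η) (inPlane (J₃ μ b χ η))) :
    OddRoots μ a b χ η (inPlane (J₃ μ b χ η)) 3 :=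
  ⟨inPlane_subset_compl J₃_disjoint_S, _, signedRoots_J₃ h, fun x _ hne => by
    rw [sign₃_pow_three]; exact sub_mul_sign₃_pos hne⟩

lemma oddRoots_three_J₄ (h : ((2 : ℕ) : ℕ∞) < numRoots (fPrime μ a b χ η) (inPlane (J₄ μ a χ η))) :
    OddRoots μ a b χ η (inPlane (J₄ μ a χ η)) 3 :=
  ⟨inPlane_subset_compl J₄_disjoint_S, _, signedRoots_J₄ h, fun x _ hne => by
    rw [sign₄_pow_three]; exact sub_mul_sign₄_pos hne⟩

lemma evenRoots_KIntervals {L : Set ℂ} (hL : L ∈ KIntervals μ a b χ η)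
    (h : ((2 * n + 1 : ℕ) : ℕ∞) < numRoots (fPrime μ a b χ η) L) :
    EvenRoots μ a b χ η L (2 * n + 2) 1 :=
  ⟨KIntervals_subset hL, _, signedRoots_KIntervals hL h, fun _ _ _ => by norm_num⟩

end Counts

/-! ### Disjointness of the domains and exhaustion of the cases -/

lemma disjoint_J₃_J₄ : Disjoint (inPlane (J₃ μ b χ η)) (inPlane (J₄ μ a χ η)) :=
  disjoint_inPlane fun _ ht ht' => lt_asymm ht.2.2.1 ht'.2.2.2

lemma disjoint_J₁_J₂ (hS : (S μ a b χ η).Nonempty) :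
    Disjoint (inPlane (J₁ μ a b χ η)) (inPlane (J₂ μ a b χ η)) :=
  let ⟨_, hx⟩ := hS
  disjoint_inPlane fun _ ht ht' => lt_asymm (lt_of_mem_J₁ ht hx) (lt_of_mem_J₂ ht' hx)

lemma disjoint_J₁_J₃ (hS : (S₁ μ b χ).Nonempty) :
    Disjoint (inPlane (J₁ μ a b χ η)) (inPlane (J₃ μ b χ η)) :=
  let ⟨_, hx⟩ := hS
  disjoint_inPlane fun _ ht ht' =>
    lt_asymm (lt_of_mem_J₁ ht (Or.inl (Or.inl hx))) (lt_of_mem_S₁ ht' hx)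

lemma disjoint_J₁_J₄ (hS : (S₁ μ b χ).Nonempty) :
    Disjoint (inPlane (J₁ μ a b χ η)) (inPlane (J₄ μ a χ η)) :=
  let ⟨_, hx⟩ := hS
  disjoint_inPlane fun _ ht ht' => lt_asymm (lt_of_mem_J₁ ht (Or.inl (Or.inl hx)))
    (ht'.2.2.2.trans_le (S₁_subset hx).1)

lemma disjoint_J₂_J₃ (hS : (S₃ μ a χ).Nonempty) :
    Disjoint (inPlane (J₂ μ a b χ η)) (inPlane (J₃ μ b χ η)) :=
  let ⟨_, hx⟩ := hS
  disjoint_inPlane fun _ ht ht' => lt_asymm (lt_of_mem_J₂ ht (Or.inr hx))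
    ((S₃_subset hx).2.trans_lt ht'.2.2.1)

lemma disjoint_J₂_J₄ (hS : (S₃ μ a χ).Nonempty) :
    Disjoint (inPlane (J₂ μ a b χ η)) (inPlane (J₄ μ a χ η)) :=
  let ⟨_, hx⟩ := hS
  disjoint_inPlane fun _ ht ht' => lt_asymm (lt_of_mem_J₂ ht (Or.inr hx)) (lt_of_mem_S₃ ht' hx)

/-- Every neighbourhood of `b` has positive mass, and none of it lies beyond `b`, since the
complement of the support is null. -/
lemma S₁_nonempty (hb : b ∈ μ.support) (hsupp : μ.support ⊆ Icc a b) (h : χ < b) :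
    (S₁ μ b χ).Nonempty := by
  rw [S₁, Measure.nonempty_support_iff, Ne, Measure.restrict_eq_zero]
  have h1 : 0 < μ (Ioi χ) := (Measure.mem_support_iff_forall b).mp hb _ (Ioi_mem_nhds h)
  have h2 : μ (Ioi χ) ≤ μ (Ioc χ b) + μ μ.supportᶜ :=
    (measure_mono fun x hx => (em (x ∈ μ.support)).imp (fun h => ⟨hx, (hsupp h).2⟩) id).trans
      (measure_union_le _ _)
  rw [Measure.measure_compl_support, add_zero] at h2
  exact (h1.trans_le h2).ne'

lemma S₃_nonempty (ha : a ∈ μ.support) (hsupp : μ.support ⊆ Icc a b) (h : a < χ) :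
    (S₃ μ a χ).Nonempty := by
  rw [S₃, Measure.nonempty_support_iff, Ne, Measure.restrict_eq_zero]
  have h1 : 0 < μ (Iio χ) := (Measure.mem_support_iff_forall a).mp ha _ (Iio_mem_nhds h)
  have h2 : μ (Iio χ) ≤ μ (Ico a χ) + μ μ.supportᶜ :=
    (measure_mono fun x hx => (em (x ∈ μ.support)).imp (fun h => ⟨(hsupp h).1, hx⟩) id).trans
      (measure_union_le _ _)
  rw [Measure.measure_compl_support, add_zero] at h2
  exact (h1.trans_le h2).ne'

lemma position_cases (ha : a ∈ μ.support) (hb : b ∈ μ.support) (hsupp : μ.support ⊆ Icc a b)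
    (hab : a < b) (hχ : χ ∈ Icc a b) : Inner μ a b χ ∨ AtLeft μ a b χ ∨ AtRight μ a b χ := by
  rcases hχ.1.eq_or_lt with rfl | h1
  · exact Or.inr (Or.inl ⟨rfl, hab, S₁_nonempty hb hsupp hab, by simp [S₃]⟩)
  rcases hχ.2.eq_or_lt with rfl | h2
  · exact Or.inr (Or.inr ⟨hab, rfl, by simp [S₁], S₃_nonempty ha hsupp hab⟩)
  · exact Or.inl ⟨h1, h2, S₁_nonempty hb hsupp h2, S₃_nonempty ha hsupp h1⟩

lemma setting_of_nonempty (hχ : χ ∈ Icc a b) (hsupp : μ.support ⊆ Icc a b)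
    (h : (S₁ μ b χ).Nonempty ∨ (S₃ μ a χ).Nonempty) : Setting μ a b χ := by
  refine ⟨hχ.1, hχ.2, hsupp, ?_⟩
  rw [← Measure.nonempty_support_iff, sideMeasure, Measure.support_add, union_nonempty]
  exact h

lemma setting_of_mem_support (ha : a ∈ μ.support) (hb : b ∈ μ.support)
    (hsupp : μ.support ⊆ Icc a b) (hab : a < b) (hχ : χ ∈ Icc a b) : Setting μ a b χ := by
  rcases position_cases ha hb hsupp hab hχ with h | h | h
  exacts [setting_of_nonempty hχ hsupp (Or.inl h.2.2.1),
    setting_of_nonempty hχ hsupp (Or.inl h.2.2.1), setting_of_nonempty hχ hsupp (Or.inr h.2.2.2)]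

lemma weight_cases (h1 : μ.real {χ} < 1) (hη : η ∈ Icc (0 : ℝ) 1) :
    Generic μ χ η ∨ Bottom μ χ η ∨ Heavy μ χ η ∨ Balanced μ χ η := by
  have hnonneg : 0 ≤ μ.real {χ} := measureReal_nonneg
  have hS : μ.real {χ} ≠ 1 - η → S₂ μ χ η = {χ} := fun h => by ext x; simp [S₂, h]
  rcases hη.1.eq_or_lt with rfl | hpos
  · have : μ.real {χ} < 1 - 0 := by linarith
    exact Or.inr (Or.inl ⟨rfl, this, hS this.ne⟩)
  rcases lt_trichotomy (μ.real {χ}) (1 - η) with h | h | h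
  · exact Or.inl ⟨hpos, by linarith, h, hS h.ne⟩
  · exact Or.inr (Or.inr (Or.inr ⟨hpos, hη.2, h.symm, by ext x; simp [S₂, h]⟩))
  · exact Or.inr (Or.inr (Or.inl ⟨hpos, hη.2, h, hS h.ne'⟩))

variable [IsProbabilityMeasure μ]

/-! ### Impossible configurations and the resulting bounds -/

lemma evenRoots_nonReal {m : ℕ}
    (h : ((2 * m : ℕ) : ℕ∞) < numRoots (fPrime μ a b χ η) nonReal) :
    EvenRoots μ a b χ η nonReal (2 * (m + 1)) 1 :=
  ⟨nonReal_subset, _, signedRoots_nonReal h, fun _ _ _ => by norm_num⟩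

variable {D D' : Set ℂ} {k k' : ℕ} {ε ε' : ℝ}

lemma EvenRoots.false (st : Setting μ a b χ) (h : EvenRoots μ a b χ η D k ε) (hk : 2 ≤ k)
    (hlead : 3 ≤ k ∨ η * ε ≤ 0) : False :=
  let ⟨hD, _, hs, hp⟩ := h
  hs.false_of_quadratic st hD hk ε hp hlead

lemma OddRoots.false (st : Setting μ a b χ) (h : OddRoots μ a b χ η D k) (hk : 1 ≤ k)
    (hlead : 2 ≤ k ∨ η ≤ 0) : False :=
  let ⟨hD, _, hs, hp⟩ := h
  hs.false_of_linear st hD hk 1 (by simpa using hp) (by simpa using hlead)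

/-- The combined pattern is that of x - χ up to a constant sign, so a linear test polynomial
applies, and two roots already exceed its degree. -/
lemma EvenRoots.false_of_odd (st : Setting μ a b χ) (h : EvenRoots μ a b χ η D k ε)
    (h' : OddRoots μ a b χ η D' k') (hd : Disjoint D D') (hk : 1 ≤ k) (hk' : 1 ≤ k') : False := by
  obtain ⟨hD, σ, hs, hp⟩ := h
  obtain ⟨hD', σ', hs', hp'⟩ := h'
  refine (hs.union hd hs').false_of_linear st (union_subset hD hD') (by omega) ε
    (fun x hx hne => ?_) (Or.inl (by omega))
  have := mul_pos (hp x hx hne) (hp' x hx hne)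
  linarith

/-- With nothing of `S` left of χ, the factor x - χ is positive on the rest of `S`; a linear test
replaces the quadratic one and saves a root. -/
lemma EvenRoots.false_of_left (st : Setting μ a b χ) (h : EvenRoots μ a b χ η D k ε)
    (hS : S₃ μ a χ = ∅) (hk : 1 ≤ k) (hlead : 2 ≤ k ∨ η * ε ≤ 0) : False := by
  obtain ⟨hD, σ, hs, hp⟩ := h
  refine hs.false_of_linear st hD hk ε (fun x hx hne => ?_) hlead
  rcases lt_or_gt_of_mem_S hx hne with ⟨-, h1⟩ | ⟨h1, -⟩
  · have := mul_pos (sub_pos.mpr h1) (hp x hx hne)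
    linarith
  · simp [hS] at h1

lemma EvenRoots.false_of_right (st : Setting μ a b χ) (h : EvenRoots μ a b χ η D k ε)
    (hS : S₁ μ b χ = ∅) (hk : 1 ≤ k) (hlead : 2 ≤ k ∨ η * -ε ≤ 0) : False := by
  obtain ⟨hD, σ, hs, hp⟩ := h
  refine hs.false_of_linear st hD hk (-ε) (fun x hx hne => ?_) hlead
  rcases lt_or_gt_of_mem_S hx hne with ⟨h1, -⟩ | ⟨-, h1⟩
  · simp [hS] at h1
  · have := mul_pos (sub_pos.mpr h1) (hp x hx hne)
    linarith

/-- The two signs agree away from χ and are opposite at χ, so the product is negative exactly where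
the measure has its nonpositive atom. A constant test suffices. -/
lemma false_of_J₃_J₄ (st : Setting μ a b χ) (hc : μ.real {χ} ≤ 1 - η)
    (h : ((0 : ℕ) : ℕ∞) < numRoots (fPrime μ a b χ η) (inPlane (J₃ μ b χ η)))
    (h' : ((0 : ℕ) : ℕ∞) < numRoots (fPrime μ a b χ η) (inPlane (J₄ μ a χ η))) : False := by
  refine ((signedRoots_J₃ h).union disjoint_J₃_J₄ (signedRoots_J₄ h')).false_of_const st
    (union_subset (inPlane_subset_compl J₃_disjoint_S) (inPlane_subset_compl J₄_disjoint_S))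
    (by norm_num) 1 (fun x hx hne => ?_) ?_
  · rcases lt_or_gt_of_ne hne with h1 | h1
    · rw [sign₃_of_le h1.le, sign₄_of_lt h1]; norm_num
    · rw [sign₃_of_gt h1, sign₄_of_ge h1.le]; norm_num
  · rw [sign₃_of_le le_rfl, sign₄_of_ge le_rfl]
    norm_num
    linarith

lemma numRoots_J₃_of_left (st : Setting μ a b χ) (hS : S₃ μ a χ = ∅) (hc : μ.real {χ} ≤ 1 - η) :
    numRoots (fPrime μ a b χ η) (inPlane (J₃ μ b χ η)) = 0 := by
  by_contra h
  refine (signedRoots_J₃ (n := 0) (pos_iff_ne_zero.mpr h)).false_of_const st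
    (inPlane_subset_compl J₃_disjoint_S) le_rfl 1 (fun x hx hne => ?_) ?_
  · rcases lt_or_gt_of_mem_S hx hne with ⟨-, h1⟩ | ⟨h1, -⟩
    · rw [sign₃_of_gt h1]; norm_num
    · simp [hS] at h1
  · rw [sign₃_of_le le_rfl]
    norm_num
    linarith

lemma numRoots_J₄_of_right (st : Setting μ a b χ) (hS : S₁ μ b χ = ∅) (hc : μ.real {χ} ≤ 1 - η) :
    numRoots (fPrime μ a b χ η) (inPlane (J₄ μ a χ η)) = 0 := by
  by_contra h
  refine (signedRoots_J₄ (n := 0) (pos_iff_ne_zero.mpr h)).false_of_const st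
    (inPlane_subset_compl J₄_disjoint_S) le_rfl (-1) (fun x hx hne => ?_) ?_
  · rcases lt_or_gt_of_mem_S hx hne with ⟨h1, -⟩ | ⟨-, h1⟩
    · simp [hS] at h1
    · rw [sign₄_of_lt h1]; norm_num
  · rw [sign₄_of_ge le_rfl]
    norm_num
    linarith

lemma SignedRoots.false_of_positive (st : Setting μ a b χ) (hc : 1 - η ≤ μ.real {χ})
    (hD : D ⊆ (inPlane (S μ a b χ η))ᶜ) {σ : ℝ → ℝ}
    (h : SignedRoots (fPrime μ a b χ η) (S μ a b χ η) D k σ) (hk : 1 ≤ k)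
    (hpos : ∀ x ∈ S μ a b χ η, 0 < ε * σ x) : False := by
  -- If the atom has weight zero, χ need not belong to `S` and the sign condition there is void;
  -- otherwise χ lies in `S₂`.
  refine h.false_of_const st hD hk ε (fun x hx _ => hpos x hx) ?_
  rcases hc.eq_or_lt with h1 | h1
  · simp [h1]
  · have h2 := hpos χ (Or.inl (Or.inr ⟨rfl, h1.ne'⟩))
    exact mul_nonneg (by linarith) h2.le

/-- If the signed measure is nonnegative, `fPrime` behaves as a Nevanlinna function. -/
theorem numRoots_of_positive (st : Setting μ a b χ) (hc : 1 - η ≤ μ.real {χ}) :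
    (∀ I ∈ ({nonReal, inPlane (J₁ μ a b χ η), inPlane (J₂ μ a b χ η)} : Set (Set ℂ)),
      numRoots (fPrime μ a b χ η) I = 0) ∧
    (∀ I ∈ ({inPlane (J₃ μ b χ η), inPlane (J₄ μ a χ η)} : Set (Set ℂ)) ∪ KIntervals μ a b χ η,
      numRoots (fPrime μ a b χ η) I ≤ 1) := by
  constructor
  · rintro I (rfl | rfl | rfl) <;> by_contra h <;> rw [← Ne, ← pos_iff_ne_zero] at h
    · exact (signedRoots_nonReal (m := 0) h).false_of_positive (ε := 1) st hc nonReal_subset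
        (by norm_num) (by norm_num)
    · exact (signedRoots_J₁ (n := 0) h).false_of_positive (ε := -1) st hc
        (inPlane_subset_compl J₁_disjoint_S) (by norm_num) (by norm_num)
    · exact (signedRoots_J₂ (n := 0) h).false_of_positive (ε := 1) st hc
        (inPlane_subset_compl J₂_disjoint_S) (by norm_num) (by norm_num)
  · rintro I ((rfl | rfl) | hI) <;> by_contra! h
    · exact (signedRoots_J₃ (n := 1) (by exact_mod_cast h)).false_of_positive (ε := 1) st hc
        (inPlane_subset_compl J₃_disjoint_S) (by norm_num) (fun x _ => by simp [sign₃_sq])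
    · exact (signedRoots_J₄ (n := 1) (by exact_mod_cast h)).false_of_positive (ε := 1) st hc
        (inPlane_subset_compl J₄_disjoint_S) (by norm_num) (fun x _ => by simp [sign₄_sq])
    · exact (signedRoots_KIntervals (n := 0) hI (by exact_mod_cast h)).false_of_positive (ε := 1)
        st hc (KIntervals_subset hI) (by norm_num) (by norm_num)

theorem numRoots_of_left (st : Setting μ a b χ) (hS : S₃ μ a χ = ∅) (hη : 0 ≤ η)
    (hc : μ.real {χ} ≤ 1 - η) :
    (∀ I ∈ ({nonReal, inPlane (J₁ μ a b χ η), inPlane (J₃ μ b χ η)} : Set (Set ℂ)),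
      numRoots (fPrime μ a b χ η) I = 0) ∧
    (∀ I ∈ ({inPlane (J₂ μ a b χ η)} : Set (Set ℂ)) ∪ KIntervals μ a b χ η,
      numRoots (fPrime μ a b χ η) I ≤ 1) ∧
    (η = 0 → numRoots (fPrime μ a b χ η) (inPlane (J₂ μ a b χ η)) = 0) := by
  refine ⟨?_, ?_, fun h0 => ?_⟩
  · rintro I (rfl | rfl | rfl)
    · by_contra h
      exact (evenRoots_nonReal (m := 0) (pos_iff_ne_zero.mpr h)).false_of_left st hS (by norm_num)
        (Or.inl (by norm_num))
    · by_contra h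
      -- One root right of `S` forces ε = -1, so the top coefficient contributes -η ≤ 0.
      exact (evenRoots_J₁ (n := 0) (pos_iff_ne_zero.mpr h)).false_of_left st hS le_rfl
        (Or.inr (by simpa using hη))
    · exact numRoots_J₃_of_left st hS hc
  · rintro I (rfl | hI) <;> by_contra! h
    · exact (evenRoots_J₂ (n := 1) (by exact_mod_cast h)).false_of_left st hS (by norm_num)
        (Or.inl le_rfl)
    · exact (evenRoots_KIntervals (n := 0) hI (by exact_mod_cast h)).false_of_left st hS
        (by norm_num) (Or.inl le_rfl)
  · by_contra h
    exact (evenRoots_J₂ (n := 0) (pos_iff_ne_zero.mpr h)).false_of_left st hS le_rfl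
      (Or.inr (by simp [h0]))

theorem numRoots_of_right (st : Setting μ a b χ) (hS : S₁ μ b χ = ∅) (hη : 0 ≤ η)
    (hc : μ.real {χ} ≤ 1 - η) :
    (∀ I ∈ ({nonReal, inPlane (J₂ μ a b χ η), inPlane (J₄ μ a χ η)} : Set (Set ℂ)),
      numRoots (fPrime μ a b χ η) I = 0) ∧
    (∀ I ∈ ({inPlane (J₁ μ a b χ η)} : Set (Set ℂ)) ∪ KIntervals μ a b χ η,
      numRoots (fPrime μ a b χ η) I ≤ 1) ∧
    (η = 0 → numRoots (fPrime μ a b χ η) (inPlane (J₁ μ a b χ η)) = 0) := by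
  refine ⟨?_, ?_, fun h0 => ?_⟩
  · rintro I (rfl | rfl | rfl)
    · by_contra h
      exact (evenRoots_nonReal (m := 0) (pos_iff_ne_zero.mpr h)).false_of_right st hS (by norm_num)
        (Or.inl (by norm_num))
    · by_contra h
      exact (evenRoots_J₂ (n := 0) (pos_iff_ne_zero.mpr h)).false_of_right st hS le_rfl
        (Or.inr (by simpa using hη))
    · exact numRoots_J₄_of_right st hS hc
  · rintro I (rfl | hI) <;> by_contra! h
    · exact (evenRoots_J₁ (n := 1) (by exact_mod_cast h)).false_of_right st hS (by norm_num)
        (Or.inl le_rfl)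
    · exact (evenRoots_KIntervals (n := 0) hI (by exact_mod_cast h)).false_of_right st hS
        (by norm_num) (Or.inl le_rfl)
  · by_contra h
    exact (evenRoots_J₁ (n := 0) (pos_iff_ne_zero.mpr h)).false_of_right st hS le_rfl
      (Or.inr (by simp [h0]))

/-- One root on each side of `S` gives ε = -1, so the quadratic test works with only two roots
because -η ≤ 0. -/
lemma false_of_J₁_J₂ (st : Setting μ a b χ) (hS : (S μ a b χ η).Nonempty) (hη : 0 ≤ η)
    (h : ((0 : ℕ) : ℕ∞) < numRoots (fPrime μ a b χ η) (inPlane (J₁ μ a b χ η)))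
    (h' : ((0 : ℕ) : ℕ∞) < numRoots (fPrime μ a b χ η) (inPlane (J₂ μ a b χ η))) : False :=
  ((evenRoots_J₁ h).union (evenRoots_J₂ h') (disjoint_J₁_J₂ hS)).false st le_rfl
    (Or.inr (by simpa using hη))

/-- With η = 0 the moment identity vanishes in the top degree as well, so every exclusion needs one
root fewer than in the generic case. -/
theorem numRoots_of_bottom (st : Setting μ a b χ) (hi : Inner μ a b χ) (h0 : η = 0) :
    (∀ I ∈ ({inPlane (J₁ μ a b χ η), inPlane (J₂ μ a b χ η)} : Set (Set ℂ)) ∪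
        KIntervals μ a b χ η, numRoots (fPrime μ a b χ η) I ≤ 1) ∧
    (∀ I ∈ ({nonReal, inPlane (J₃ μ b χ η), inPlane (J₄ μ a χ η)} : Set (Set ℂ)),
      numRoots (fPrime μ a b χ η) I = 0) ∧
    (∀ I ∈ ({inPlane (J₁ μ a b χ η), inPlane (J₂ μ a b χ η)} : Set (Set ℂ)),
      numRoots (fPrime μ a b χ η) I = 1 →
        ∀ I' ∈ ({inPlane (J₁ μ a b χ η), inPlane (J₂ μ a b χ η)} : Set (Set ℂ)) \ {I},
          numRoots (fPrime μ a b χ η) I' = 0) := by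
  have hS : (S μ a b χ η).Nonempty := hi.2.2.1.mono fun _ h => Or.inl (Or.inl h)
  refine ⟨?_, ?_, ?_⟩
  · rintro I ((rfl | rfl) | hI) <;> by_contra! h
    · exact (evenRoots_J₁ (n := 1) (by exact_mod_cast h)).false st le_rfl (Or.inr (by simp [h0]))
    · exact (evenRoots_J₂ (n := 1) (by exact_mod_cast h)).false st le_rfl (Or.inr (by simp [h0]))
    · exact (evenRoots_KIntervals (n := 0) hI (by exact_mod_cast h)).false st le_rfl
        (Or.inr (by simp [h0]))
  · rintro I (rfl | rfl | rfl) <;> by_contra h <;> rw [← Ne, ← pos_iff_ne_zero] at h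
    · exact (evenRoots_nonReal (m := 0) h).false st (by norm_num) (Or.inr (by simp [h0]))
    · exact (oddRoots_J₃ h).false st le_rfl (Or.inr h0.le)
    · exact (oddRoots_J₄ h).false st le_rfl (Or.inr h0.le)
  · rintro I hI h1 I' ⟨hI', hne⟩
    by_contra h'
    rw [← Ne, ← pos_iff_ne_zero] at h'
    have h : 0 < numRoots (fPrime μ a b χ η) I := by rw [h1]; exact one_pos
    rcases hI with rfl | rfl <;> rcases hI' with rfl | rfl
    · exact hne rfl
    · exact false_of_J₁_J₂ st hS h0.ge h h'
    · exact false_of_J₁_J₂ st hS h0.ge h' h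
    · exact hne rfl

/-- In the generic case two of the exceptional domains cannot both contain a root. -/
theorem false_of_exceptional_pair (st : Setting μ a b χ) (hi : Inner μ a b χ) (hη : 0 ≤ η)
    (hc : μ.real {χ} ≤ 1 - η) {I I' : Set ℂ}
    (hI : I ∈ ({nonReal, inPlane (J₁ μ a b χ η), inPlane (J₂ μ a b χ η), inPlane (J₃ μ b χ η),
      inPlane (J₄ μ a χ η)} : Set (Set ℂ)))
    (hI' : I' ∈ ({nonReal, inPlane (J₁ μ a b χ η), inPlane (J₂ μ a b χ η), inPlane (J₃ μ b χ η),
      inPlane (J₄ μ a χ η)} : Set (Set ℂ))) (hne : I ≠ I')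
    (h : 0 < numRoots (fPrime μ a b χ η) I) (h' : 0 < numRoots (fPrime μ a b χ η) I') : False := by
  have hS : (S μ a b χ η).Nonempty := hi.2.2.1.mono fun _ h => Or.inl (Or.inl h)
  have nonReal_inPlane : ∀ A : Set ℝ, 0 < numRoots (fPrime μ a b χ η) nonReal →
      (∃ ε, EvenRoots μ a b χ η (inPlane A) 1 ε) ∨ OddRoots μ a b χ η (inPlane A) 1 → False := by
    rintro A h (⟨ε, h'⟩ | h')
    · exact ((evenRoots_nonReal (m := 0) h).union h' (disjoint_nonReal_inPlane A)).false st
        (by norm_num) (Or.inl (by norm_num))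
    · exact (evenRoots_nonReal (m := 0) h).false_of_odd st h' (disjoint_nonReal_inPlane A)
        (by norm_num) le_rfl
  have r₁ := nonReal_inPlane (J₁ μ a b χ η)
  have r₂ := nonReal_inPlane (J₂ μ a b χ η)
  have r₃ := nonReal_inPlane (J₃ μ b χ η)
  have r₄ := nonReal_inPlane (J₄ μ a χ η)
  rcases hI with rfl | rfl | rfl | rfl | rfl <;> rcases hI' with rfl | rfl | rfl | rfl | rfl
  · exact hne rfl
  · exact r₁ h (Or.inl ⟨_, evenRoots_J₁ (n := 0) h'⟩)
  · exact r₂ h (Or.inl ⟨_, evenRoots_J₂ (n := 0) h'⟩)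
  · exact r₃ h (Or.inr (oddRoots_J₃ h'))
  · exact r₄ h (Or.inr (oddRoots_J₄ h'))
  · exact r₁ h' (Or.inl ⟨_, evenRoots_J₁ (n := 0) h⟩)
  · exact hne rfl
  · exact false_of_J₁_J₂ st hS hη h h'
  · exact (evenRoots_J₁ (n := 0) h).false_of_odd st (oddRoots_J₃ h') (disjoint_J₁_J₃ hi.2.2.1)
      le_rfl le_rfl
  · exact (evenRoots_J₁ (n := 0) h).false_of_odd st (oddRoots_J₄ h') (disjoint_J₁_J₄ hi.2.2.1)
      le_rfl le_rfl
  · exact r₂ h' (Or.inl ⟨_, evenRoots_J₂ (n := 0) h⟩)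
  · exact false_of_J₁_J₂ st hS hη h' h
  · exact hne rfl
  · exact (evenRoots_J₂ (n := 0) h).false_of_odd st (oddRoots_J₃ h') (disjoint_J₂_J₃ hi.2.2.2)
      le_rfl le_rfl
  · exact (evenRoots_J₂ (n := 0) h).false_of_odd st (oddRoots_J₄ h') (disjoint_J₂_J₄ hi.2.2.2)
      le_rfl le_rfl
  · exact r₃ h' (Or.inr (oddRoots_J₃ h))
  · exact (evenRoots_J₁ (n := 0) h').false_of_odd st (oddRoots_J₃ h) (disjoint_J₁_J₃ hi.2.2.1)
      le_rfl le_rfl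
  · exact (evenRoots_J₂ (n := 0) h').false_of_odd st (oddRoots_J₃ h) (disjoint_J₂_J₃ hi.2.2.2)
      le_rfl le_rfl
  · exact hne rfl
  · exact false_of_J₃_J₄ st hc h h'
  · exact r₄ h' (Or.inr (oddRoots_J₄ h))
  · exact (evenRoots_J₁ (n := 0) h').false_of_odd st (oddRoots_J₄ h) (disjoint_J₁_J₄ hi.2.2.1)
      le_rfl le_rfl
  · exact (evenRoots_J₂ (n := 0) h').false_of_odd st (oddRoots_J₄ h) (disjoint_J₂_J₄ hi.2.2.2)
      le_rfl le_rfl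
  · exact false_of_J₃_J₄ st hc h' h
  · exact hne rfl

/-- In the generic case, a root in an exceptional domain excludes two roots in a component of `K`. -/
theorem false_of_exceptional_KIntervals (st : Setting μ a b χ) {I L : Set ℂ}
    (hI : I ∈ ({nonReal, inPlane (J₁ μ a b χ η), inPlane (J₂ μ a b χ η), inPlane (J₃ μ b χ η),
      inPlane (J₄ μ a χ η)} : Set (Set ℂ))) (hL : L ∈ KIntervals μ a b χ η)
    (h : 0 < numRoots (fPrime μ a b χ η) I) (h' : 1 < numRoots (fPrime μ a b χ η) L) : False := by
  have hK := evenRoots_KIntervals (n := 0) hL (by exact_mod_cast h')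
  rcases hI with rfl | rfl | rfl | rfl | rfl
  · exact ((evenRoots_nonReal (m := 0) h).union hK (disjoint_nonReal_KIntervals hL)).false st
      (by norm_num) (Or.inl (by norm_num))
  · exact ((evenRoots_J₁ (n := 0) h).union hK (disjoint_KIntervals_J hL
      fun _ h => Or.inl (Or.inl (Or.inl h)))).false st (by norm_num) (Or.inl (by norm_num))
  · exact ((evenRoots_J₂ (n := 0) h).union hK (disjoint_KIntervals_J hL
      fun _ h => Or.inl (Or.inl (Or.inr h)))).false st (by norm_num) (Or.inl (by norm_num))
  · exact hK.false_of_odd st (oddRoots_J₃ h) (disjoint_KIntervals_J hL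
      fun _ h => Or.inl (Or.inr h)).symm (by norm_num) le_rfl
  · exact hK.false_of_odd st (oddRoots_J₄ h) (disjoint_KIntervals_J hL
      fun _ h => Or.inr h).symm (by norm_num) le_rfl

/-- Three roots beat the quadratic test for an even pattern; the cube of an odd pattern is odd, so
the linear test covers `J₃` and `J₄`. -/
theorem numRoots_exceptional_le (st : Setting μ a b χ) {I : Set ℂ}
    (hI : I ∈ ({nonReal, inPlane (J₁ μ a b χ η), inPlane (J₂ μ a b χ η), inPlane (J₃ μ b χ η),
      inPlane (J₄ μ a χ η)} : Set (Set ℂ))) : numRoots (fPrime μ a b χ η) I ≤ 2 := by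
  by_contra! h
  rcases hI with rfl | rfl | rfl | rfl | rfl
  · exact (evenRoots_nonReal (m := 1) (by exact_mod_cast h)).false st (by norm_num)
      (Or.inl (by norm_num))
  · exact (evenRoots_J₁ (n := 2) (by exact_mod_cast h)).false st (by norm_num) (Or.inl le_rfl)
  · exact (evenRoots_J₂ (n := 2) (by exact_mod_cast h)).false st (by norm_num) (Or.inl le_rfl)
  · exact (oddRoots_three_J₃ (a := a) (by exact_mod_cast h)).false st (by norm_num)
      (Or.inl (by norm_num))
  · exact (oddRoots_three_J₄ (b := b) (by exact_mod_cast h)).false st (by norm_num)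
      (Or.inl (by norm_num))

theorem numRoots_KIntervals_le (st : Setting μ a b χ) {L : Set ℂ}
    (hL : L ∈ KIntervals μ a b χ η) : numRoots (fPrime μ a b χ η) L ≤ 3 := by
  by_contra! h
  exact (evenRoots_KIntervals (n := 1) hL (by exact_mod_cast h)).false st (by norm_num)
    (Or.inl (by norm_num))

theorem false_of_KIntervals_pair (st : Setting μ a b χ) {L L' : Set ℂ}
    (hL : L ∈ KIntervals μ a b χ η) (hL' : L' ∈ KIntervals μ a b χ η) (hne : L ≠ L')
    (h : 1 < numRoots (fPrime μ a b χ η) L) (h' : 1 < numRoots (fPrime μ a b χ η) L') : False :=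
  ((evenRoots_KIntervals (n := 0) hL (by exact_mod_cast h)).union
    (evenRoots_KIntervals (n := 0) hL' (by exact_mod_cast h'))
    (disjoint_KIntervals hL hL' hne)).false st (by norm_num) (Or.inl (by norm_num))

/-- The support has two distinct points, so some mass lies away from χ. This rules out η = 0 with a
balanced atom, which none of the four weight conditions covers. -/
lemma measureReal_singleton_lt_one (ha : a ∈ μ.support) (hb : b ∈ μ.support) (hab : a < b) :
    μ.real {χ} < 1 := by
  obtain ⟨c, hc, hne⟩ : ∃ c ∈ μ.support, c ≠ χ := by
    by_cases h : a = χ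
    · exact ⟨b, hb, by rw [← h]; exact hab.ne'⟩
    · exact ⟨a, ha, h⟩
  have h1 : 0 < μ {χ}ᶜ :=
    (Measure.mem_support_iff_forall c).mp hc _ (isOpen_compl_singleton.mem_nhds hne)
  have h2 : 0 < μ.real {χ}ᶜ := ENNReal.toReal_pos h1.ne' (measure_ne_top _ _)
  rw [probReal_compl_eq_one_sub (measurableSet_singleton χ)] at h2
  linarith

end Cases

end GapRoots

/-! ### The twelve cases assembled -/

open GapRoots in
theorem mainTheorem7 (μ : MeasureTheory.Measure ℝ) [MeasureTheory.IsProbabilityMeasure μ]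
    (a b χ η : ℝ) (hab : a < b) (hsupp : μ.support ⊆ Set.Icc a b)
    (ha : a ∈ μ.support) (hb : b ∈ μ.support)
    (hχ : χ ∈ Set.Icc a b) (hη : η ∈ Set.Icc (0 : ℝ) 1)
    (N : Set ℂ → ℕ∞) (hN : N = numRoots (fPrime μ a b χ η))
    (J1 J2 J3 J4 : Set ℂ) (hJ1 : J1 = inPlane (J₁ μ a b χ η)) (hJ2 : J2 = inPlane (J₂ μ a b χ η))
    (hJ3 : J3 = inPlane (J₃ μ b χ η)) (hJ4 : J4 = inPlane (J₄ μ a χ η))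
    (Ks : Set (Set ℂ)) (hKs : Ks = KIntervals μ a b χ η) :
    -- `fPrime` is the analytic extension of `C(w) - (1 - η) / (w - χ)` to `ℂ \ S`
    (∀ w ∈ (inPlane (μ.support ∪ {χ}))ᶜ,
      fPrime μ a b χ η w = cauchyTransform μ w - (1 - (η : ℂ)) / (w - (χ : ℂ))) ∧
    AnalyticOnNhd ℂ (fPrime μ a b χ η) (inPlane (S μ a b χ η))ᶜ ∧
    -- the twelve cases exhaust all possibilities
    ((Inner μ a b χ ∨ AtLeft μ a b χ ∨ AtRight μ a b χ) ∧
      (Generic μ χ η ∨ Bottom μ χ η ∨ Heavy μ χ η ∨ Balanced μ χ η)) ∧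
    -- (a)
    (Inner μ a b χ → Generic μ χ η →
      (∀ I ∈ ({nonReal, J1, J2, J3, J4} : Set (Set ℂ)), N I ≤ 2) ∧
      (∀ L ∈ Ks, N L ≤ 3) ∧
      (∀ I ∈ ({nonReal, J1, J2, J3, J4} : Set (Set ℂ)), (N I = 1 ∨ N I = 2) →
        (∀ I' ∈ ({nonReal, J1, J2, J3, J4} : Set (Set ℂ)) \ {I}, N I' = 0) ∧
        (∀ L ∈ Ks, N L ≤ 1)) ∧
      (∀ L ∈ Ks, (N L = 2 ∨ N L = 3) →
        (∀ I ∈ ({nonReal, J1, J2, J3, J4} : Set (Set ℂ)), N I = 0) ∧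
        (∀ L' ∈ Ks \ {L}, N L' ≤ 1))) ∧
    -- (b)
    (Inner μ a b χ → Bottom μ χ η →
      (∀ I ∈ ({J1, J2} : Set (Set ℂ)) ∪ Ks, N I ≤ 1) ∧
      (∀ I ∈ ({nonReal, J3, J4} : Set (Set ℂ)), N I = 0) ∧
      (∀ I ∈ ({J1, J2} : Set (Set ℂ)), N I = 1 →
        ∀ I' ∈ ({J1, J2} : Set (Set ℂ)) \ {I}, N I' = 0)) ∧
    -- (c)
    (Inner μ a b χ → Heavy μ χ η →
      (∀ I ∈ ({nonReal, J1, J2} : Set (Set ℂ)), N I = 0) ∧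
      (∀ I ∈ ({J3, J4} : Set (Set ℂ)) ∪ Ks, N I ≤ 1)) ∧
    -- (d)
    (Inner μ a b χ → Balanced μ χ η →
      (∀ I ∈ ({nonReal, J1, J2} : Set (Set ℂ)), N I = 0) ∧
      (∀ L ∈ Ks, N L ≤ 1)) ∧
    -- (e)
    (AtLeft μ a b χ → Generic μ χ η →
      (∀ I ∈ ({nonReal, J1, J3} : Set (Set ℂ)), N I = 0) ∧
      (∀ I ∈ ({J2} : Set (Set ℂ)) ∪ Ks, N I ≤ 1)) ∧
    -- (f)
    (AtLeft μ a b χ → Bottom μ χ η →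
      (∀ I ∈ ({nonReal, J1, J2, J3} : Set (Set ℂ)), N I = 0) ∧
      (∀ L ∈ Ks, N L ≤ 1)) ∧
    -- (g)
    (AtLeft μ a b χ → Heavy μ χ η →
      (∀ I ∈ ({nonReal, J1, J2} : Set (Set ℂ)), N I = 0) ∧
      (∀ I ∈ ({J3} : Set (Set ℂ)) ∪ Ks, N I ≤ 1)) ∧
    -- (h)
    (AtLeft μ a b χ → Balanced μ χ η →
      (∀ I ∈ ({nonReal, J1, J2} : Set (Set ℂ)), N I = 0) ∧
      (∀ L ∈ Ks, N L ≤ 1)) ∧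
    -- (i)
    (AtRight μ a b χ → Generic μ χ η →
      (∀ I ∈ ({nonReal, J2, J4} : Set (Set ℂ)), N I = 0) ∧
      (∀ I ∈ ({J1} : Set (Set ℂ)) ∪ Ks, N I ≤ 1)) ∧
    -- (j)
    (AtRight μ a b χ → Bottom μ χ η →
      (∀ I ∈ ({nonReal, J1, J2, J4} : Set (Set ℂ)), N I = 0) ∧
      (∀ L ∈ Ks, N L ≤ 1)) ∧
    -- (k)
    (AtRight μ a b χ → Heavy μ χ η →
      (∀ I ∈ ({nonReal, J1, J2} : Set (Set ℂ)), N I = 0) ∧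
      (∀ I ∈ ({J4} : Set (Set ℂ)) ∪ Ks, N I ≤ 1)) ∧
    -- (l)
    (AtRight μ a b χ → Balanced μ χ η →
      (∀ I ∈ ({nonReal, J1, J2} : Set (Set ℂ)), N I = 0) ∧
      (∀ L ∈ Ks, N L ≤ 1)) := by
  subst hN hJ1 hJ2 hJ3 hJ4 hKs
  have hset := setting_of_mem_support ha hb hsupp hab hχ
  refine ⟨fun w hw => fPrime_eq_cauchyTransform hχ.1 hχ.2 hsupp hw, analyticOnNhd_fPrime,
    ⟨position_cases ha hb hsupp hab hχ, weight_cases (measureReal_singleton_lt_one ha hb hab) hη⟩,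
    fun hi hg => ?_, fun hi hg => numRoots_of_bottom hset hi hg.1, fun _ hg => ?_,
    fun _ hg => ?_, fun hl hg => ?_, fun hl hg => ?_, fun _ hg => ?_, fun _ hg => ?_,
    fun hr hg => ?_, fun hr hg => ?_, fun _ hg => ?_, fun _ hg => ?_⟩
  · refine ⟨fun I hI => numRoots_exceptional_le hset hI,
      fun L hL => numRoots_KIntervals_le hset hL, fun I hI h => ?_, fun L hL h => ?_⟩
    · have hpos : 0 < numRoots (fPrime μ a b χ η) I := by
        rcases h with h | h <;> rw [h] <;> norm_num
      refine ⟨fun I' hI' => ?_, fun L hL => ?_⟩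
      · by_contra h'
        exact false_of_exceptional_pair hset hi hg.1.le hg.2.2.1.le hI hI'.1
          (fun e => hI'.2 e.symm) hpos (pos_iff_ne_zero.mpr h')
      · by_contra! h'
        exact false_of_exceptional_KIntervals hset hI hL hpos h'
    · have hpos : 1 < numRoots (fPrime μ a b χ η) L := by
        rcases h with h | h <;> rw [h] <;> norm_num
      refine ⟨fun I hI => ?_, fun L' hL' => ?_⟩
      · by_contra h'
        exact false_of_exceptional_KIntervals hset hI hL (pos_iff_ne_zero.mpr h') hpos
      · by_contra! h'
        exact false_of_KIntervals_pair hset hL hL'.1 (fun e => hL'.2 e.symm) hpos h'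
  · exact numRoots_of_positive hset hg.2.2.1.le
  · obtain ⟨h1, h2⟩ := numRoots_of_positive hset hg.2.2.1.le
    exact ⟨h1, fun L hL => h2 L (Or.inr hL)⟩
  · obtain ⟨h1, h2, -⟩ := numRoots_of_left hset hl.2.2.2 hη.1 hg.2.2.1.le
    exact ⟨h1, h2⟩
  · obtain ⟨h1, h2, h3⟩ := numRoots_of_left hset hl.2.2.2 hη.1 hg.2.1.le
    refine ⟨?_, fun L hL => h2 L (Or.inr hL)⟩
    rintro I (rfl | rfl | rfl | rfl)
    exacts [h1 _ (by simp), h1 _ (by simp), h3 hg.1, h1 _ (by simp)]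
  · obtain ⟨h1, h2⟩ := numRoots_of_positive hset hg.2.2.1.le
    exact ⟨h1, fun I hI => h2 I (hI.imp_left fun h => Or.inl h)⟩
  · obtain ⟨h1, h2⟩ := numRoots_of_positive hset hg.2.2.1.le
    exact ⟨h1, fun L hL => h2 L (Or.inr hL)⟩
  · obtain ⟨h1, h2, -⟩ := numRoots_of_right hset hr.2.2.1 hη.1 hg.2.2.1.le
    exact ⟨h1, h2⟩
  · obtain ⟨h1, h2, h3⟩ := numRoots_of_right hset hr.2.2.1 hη.1 hg.2.1.le
    refine ⟨?_, fun L hL => h2 L (Or.inr hL)⟩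
    rintro I (rfl | rfl | rfl | rfl)
    exacts [h1 _ (by simp), h3 hg.1, h1 _ (by simp), h1 _ (by simp)]
  · obtain ⟨h1, h2⟩ := numRoots_of_positive hset hg.2.2.1.le
    exact ⟨h1, fun I hI => h2 I (hI.imp_left fun h => Or.inr h)⟩
  · obtain ⟨h1, h2⟩ := numRoots_of_positive hset hg.2.2.1.le
    exact ⟨h1, fun L hL => h2 L (Or.inr hL)⟩
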